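/- Let $d\in\mathbb N$, $0<k<d-1$, $V(x)=|x|^{-k}$ on $\mathbb R^d$, and let $p,q$ satisfy $\max\{\frac d{2k},1\}<p<\frac dk<q<\infty$. A *cutoff* is a function $\zeta\in C^\infty(\mathbb R^d)$ with $0\le\zeta\le1$, $\zeta=0$ on $B_1(0)$ and $\zeta=1$ outside $B_2(0)$; put $\zeta_\delta(x)=\zeta(x/\delta)$ for $0<\delta<1$. Let $\|f\|_{L^p+L^q}=\inf(\|f_1\|_p+\|f_2\|_q)$ over splittings $f=f_1+f_2$ with $f_1\in L^p$, $f_2\in L^q$. There are a constant $C_0=C_0(d,k,p,q)>0$ and constants $C(A)=C(A,d,k,p,q)>0$ ($A>0$) such that for every $r\in\mathbb N$ there is a family $V_\varepsilon\in C^r(\mathbb R^d)$, $0<\varepsilon<1$, with the following properties. (a) The family regularizes $V$: (i) $\widehat{V_\varepsilon}\ge0$ (as a tempered distribution); (ii) $\|V_\varepsilon-V\|_{L^p+L^q}\le\eta(\varepsilon)$ with $\eta(\varepsilon)\to0$ as $\varepsilon\to0$; (iii) $\|\zeta_\delta(V_\varepsilon-V)\|_{L^p+L^q}\le C_0\big(\varepsilon\,\delta^{-(k+1-d/q)}+\delta^{d/p-k}\big)$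 for every cutoff $\zeta$ and all $\varepsilon,\delta\in(0,1)$; (iv) $V_\varepsilon(x)\le V(x)+\varepsilon$ for all $x\neq0$; (v) $\|V_\varepsilon\|_\infty\le 1/\Theta(\varepsilon)$ with $\Theta(\varepsilon)>0$, $\Theta(\varepsilon)\to0$ as $\varepsilon\to0$. (b) There is a function $\omega_1$ with $\omega_1(s)\to0$ as $s\to0^+$ such that for every cutoff $\zeta$, every $\sigma>2d$ and every $A>0$ there is a function $\omega_2$ with $\omega_2(s)\to0$ as $s\to0^+$ for which the following holds. Let $\mu\in L^1\cap L^\infty(\mathbb R^d)$ be any probability density with $\|\mu\|_\infty\le A$, let $N\ge1$, let $x_1,\dots,x_N\in\mathbb R^d$ be pairwise distinct, let $m_1,\dots,m_N\ge0$ with $\sum_i m_i=N$ and $m_i\le\overline M$ for some $\overline M>0$, and let $\mu_N=\frac1N\sum_i m_i\delta_{x_i}$. Then the renormalized energy $$\mathcal E_N(\mu,\mu_N)=\int_{x\ne y}V(x-y)\,(\mu_N-\mu)^{\otimes2}(dx\,dy)$$ is well defined (the four integrals obtained by expanding $(\mu_N-\mu)^{\otimes2}$ converge absolutely), and for all $\varepsilon,\delta\in(0,1)$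 $$\mathcal E_N(\mu,\mu_N)\ \ge\ -\frac{\overline M\,\|V_\varepsilon\|_\infty}{N}-C(A)\Big(\frac{\varepsilon}{\delta^{k+1-d/q}}+\delta^{\frac dp-k}+\omega_1(\varepsilon)\Big)$$ and $$\frac1{N^2}\sum_{i\ne j}m_im_j\,\big((1-\zeta_\delta)V\big)(x_i-x_j)\ \le\ C(A)\big(\mathcal E_N(\mu,\mu_N)+\mathcal O(\varepsilon,\delta,N)\big),$$ $$\mathcal O(\varepsilon,\delta,N)=\frac{\varepsilon}{\delta^{k+1-d/q}}+\delta^{d-k-\frac\sigma2}\,\omega_2(\varepsilon/\delta)+\frac{\overline M\,\|V_\varepsilon\|_\infty}{N}+\delta^{\frac dp-k}.$$ -/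

import Mathlib

open MeasureTheory Filter Topology
open scoped ContDiff ENNReal SchwartzMap FourierTransform ComplexOrder

noncomputable section

/-- The repulsive power-law potential `V(x) = |x|^{-k}` on `ℝ^d`. Its value at the origin plays no
role below. -/
def powerPotential (d : ℕ) (k : ℝ) (x : EuclideanSpace ℝ (Fin d)) : ℝ :=
  1 / ‖x‖ ^ k

/-- A smooth cutoff `0 ≤ ζ ≤ 1` that vanishes on `B_1(0)` and equals `1` outside `B_2(0)`. -/
structure IsCutoff (d : ℕ) (ζ : EuclideanSpace ℝ (Fin d) → ℝ) : Prop where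
  contDiff : ContDiff ℝ ∞ ζ
  nonneg : ∀ x, 0 ≤ ζ x
  le_one : ∀ x, ζ x ≤ 1
  eq_zero : ∀ x ∈ Metric.ball (0 : EuclideanSpace ℝ (Fin d)) 1, ζ x = 0
  eq_one : ∀ x ∉ Metric.ball (0 : EuclideanSpace ℝ (Fin d)) 2, ζ x = 1

/-- The rescaled cutoff `ζ_δ(x) = ζ(x / δ)`. -/
def rescale {d : ℕ} (ζ : EuclideanSpace ℝ (Fin d) → ℝ) (δ : ℝ) (x : EuclideanSpace ℝ (Fin d)) : ℝ :=
  ζ (δ⁻¹ • x)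

/-- The norm of `L^p + L^q`: the infimum of `‖g‖_p + ‖h‖_q` over all splittings `f = g + h` (almost
everywhere) with `g ∈ L^p` and `h ∈ L^q`. It is `∞` if there is no such splitting. -/
def sumNorm {d : ℕ} (p q : ℝ) (f : EuclideanSpace ℝ (Fin d) → ℝ) : ℝ≥0∞ :=
  ⨅ (g : EuclideanSpace ℝ (Fin d) → ℝ) (h : EuclideanSpace ℝ (Fin d) → ℝ)
    (_ : MemLp g (ENNReal.ofReal p) volume) (_ : MemLp h (ENNReal.ofReal q) volume)
    (_ : f =ᵐ[volume] g + h),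
    eLpNorm g (ENNReal.ofReal p) volume + eLpNorm h (ENNReal.ofReal q) volume

/-- The Fourier transform of the bounded function `f`, taken in the sense of tempered
distributions (`⟨𝓕 f, φ⟩ = ⟨f, 𝓕 φ⟩`), is non-negative: it is non-negative (in particular real) on
every non-negative Schwartz function. -/
def FourierNonneg {d : ℕ} (f : EuclideanSpace ℝ (Fin d) → ℝ) : Prop :=
  ∀ φ : 𝓢(EuclideanSpace ℝ (Fin d), ℂ), (∀ ξ, 0 ≤ φ ξ) → 0 ≤ ∫ x, (𝓕 φ) x * (f x : ℂ)

/-- `(V_ε)_{0 < ε < 1}` is a `C^r` approximation of `V(x) = |x|^{-k}` with the five properties used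
for the regularization of the potential; `C₀` is the constant in the truncated bound. -/
structure IsRegularization (d : ℕ) (k p q C₀ : ℝ) (r : ℕ)
    (Vε : ℝ → EuclideanSpace ℝ (Fin d) → ℝ) : Prop where
  contDiff : ∀ ε, 0 < ε → ε < 1 → ContDiff ℝ r (Vε ε)
  fourier_nonneg : ∀ ε, 0 < ε → ε < 1 → FourierNonneg (Vε ε)
  approx : ∃ η : ℝ → ℝ, Tendsto η (𝓝[>] 0) (𝓝 0) ∧ ∀ ε, 0 < ε → ε < 1 →
    sumNorm p q (fun x => Vε ε x - powerPotential d k x) ≤ ENNReal.ofReal (η ε)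
  approx_cutoff : ∀ ζ, IsCutoff d ζ → ∀ ε, 0 < ε → ε < 1 → ∀ δ, 0 < δ → δ < 1 →
    sumNorm p q (fun x => rescale ζ δ x * (Vε ε x - powerPotential d k x)) ≤
      ENNReal.ofReal (C₀ * (ε / δ ^ (k + 1 - d / q) + δ ^ (d / p - k)))
  le_add : ∀ ε, 0 < ε → ε < 1 → ∀ x, x ≠ 0 → Vε ε x ≤ powerPotential d k x + ε
  bounded : ∃ Θ : ℝ → ℝ, Tendsto Θ (𝓝[>] 0) (𝓝 0) ∧ ∀ ε, 0 < ε → ε < 1 →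
    0 < Θ ε ∧ eLpNorm (Vε ε) ∞ volume ≤ ENNReal.ofReal (1 / Θ ε)

/-- The sup norm `‖f‖_∞` as a real number (used only for bounded functions). -/
def supNorm {d : ℕ} (f : EuclideanSpace ℝ (Fin d) → ℝ) : ℝ :=
  (eLpNorm f ∞ volume).toReal

/-- The measure `ρ(x) dx`. -/
def densityMeasure {d : ℕ} (ρ : EuclideanSpace ℝ (Fin d) → ℝ) :
    Measure (EuclideanSpace ℝ (Fin d)) :=
  volume.withDensity fun x => ENNReal.ofReal (ρ x)

/-- `ρ ∈ L^1 ∩ L^∞` is a probability density. -/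
structure IsBoundedDensity {d : ℕ} (ρ : EuclideanSpace ℝ (Fin d) → ℝ) : Prop where
  integrable : Integrable ρ volume
  memLp_top : MemLp ρ ∞ volume
  nonneg : ∀ᵐ x, 0 ≤ ρ x
  integral_eq_one : ∫ x, ρ x = 1

/-- Admissible weights: `m_i ≥ 0` and `∑ m_i = N`. -/
structure IsWeight {N : ℕ} (m : Fin N → ℝ) : Prop where
  nonneg : ∀ i, 0 ≤ m i
  sum_eq : ∑ i, m i = N

/-- The weighted empirical measure `μ_N = (1/N) ∑ m_i δ_{x_i}`. -/
def empiricalMeasure {d N : ℕ} (x : Fin N → EuclideanSpace ℝ (Fin d)) (m : Fin N → ℝ) :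
    Measure (EuclideanSpace ℝ (Fin d)) :=
  ∑ i, ENNReal.ofReal (m i / N) • Measure.dirac (x i)

/-- The off-diagonal region `{x ≠ y}`. -/
def offDiagonal (d : ℕ) : Set (EuclideanSpace ℝ (Fin d) × EuclideanSpace ℝ (Fin d)) :=
  {z | z.1 ≠ z.2}

/-- The off-diagonal interaction `∫_{x ≠ y} V(x - y) α(dx) β(dy)` of two measures. -/
def interaction (d : ℕ) (k : ℝ) (α β : Measure (EuclideanSpace ℝ (Fin d))) : ℝ :=
  ∫ z in offDiagonal d, powerPotential d k (z.1 - z.2) ∂(α.prod β)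

/-- Absolute convergence of the integral in `interaction`. -/
def InteractionConverges (d : ℕ) (k : ℝ) (α β : Measure (EuclideanSpace ℝ (Fin d))) : Prop :=
  IntegrableOn (fun z : EuclideanSpace ℝ (Fin d) × EuclideanSpace ℝ (Fin d) =>
    powerPotential d k (z.1 - z.2)) (offDiagonal d) (α.prod β)

/-- The renormalized modulated energy
`𝓔_N(μ, μ_N) = ∫_{x ≠ y} V(x - y) (μ_N - μ)^{⊗2}(dx dy)`; the signed measure `(μ_N - μ)^{⊗2}` is
`μ_N ⊗ μ_N - μ_N ⊗ μ - μ ⊗ μ_N + μ ⊗ μ`. -/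
def renormalizedEnergy (d : ℕ) (k : ℝ) (μ μN : Measure (EuclideanSpace ℝ (Fin d))) : ℝ :=
  interaction d k μN μN - interaction d k μN μ - interaction d k μ μN + interaction d k μ μ

/-- The truncated near-diagonal interaction
`(1/N²) ∑_{i ≠ j} m_i m_j (1 - ζ_δ)(x_i - x_j) V(x_i - x_j)`. -/
def truncatedInteraction {d N : ℕ} (k : ℝ) (ζ : EuclideanSpace ℝ (Fin d) → ℝ) (δ : ℝ)
    (x : Fin N → EuclideanSpace ℝ (Fin d)) (m : Fin N → ℝ) : ℝ :=
  1 / (N : ℝ) ^ 2 * ∑ ij ∈ (Finset.univ : Finset (Fin N)).offDiag,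
    m ij.1 * m ij.2 * ((1 - rescale ζ δ (x ij.1 - x ij.2)) * powerPotential d k (x ij.1 - x ij.2))

end

/-! The potential is a superposition of Gaussians: `|x|^{-k}` equals `Γ(k/2)⁻¹ ∫_0^∞ e^{-t|x|²}
t^{k/2-1} dt`. Let `V_ε` keep only the frequencies `t ≤ ε⁻²`. It is smooth, bounded by a multiple of
`ε^{-k}`, and a positive mixture of Gaussians, hence has non-negative Fourier transform and is
positive definite. The remainder is `V - V_ε = ε^{-k} U(x/ε)` with `U = singularPart` non-negative,
as singular as `V` at the origin, and decaying faster than any power. Scaling then gives all the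
approximation bounds (`exists_isRegularization_regularization`).

For the energy, split `V = V_ε + (V - V_ε)`. The `V_ε` part is non-negative
(`isPosDefKernel_regularization`, `pairEnergy_nonneg`). In the remainder part, the diagonal costs
the self-interaction, at most `M V_ε(0)/N`; each cross term costs at most `A ‖V - V_ε‖_1`, of order
`ε^{d-k}`; the `μ ⊗ μ` term is non-negative. What is left is the off-diagonal particle sum of `V -
V_ε`, which is therefore bounded by the energy plus these errors (`sum_remainder_le`). Since this
sum is non-negative, the lower bound follows.

For the near-field bound, `V` is at most a constant times `V - V_{ε'}` on `|x| < 2δ` as soon as `ε'`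
is at least a fixed multiple of `δ` (`exists_le_singularPart`). The same inequality is therefore
used at the scale `ε' = max ε (l δ)`. Enlarging the scale only lowers the self-interaction, and a
small `l`, depending on `A`, keeps the cross error within the allowed one (`mul_max_rpow_le`). -/

noncomputable section

/-! ### Incomplete Gamma integrals. -/

/-- The lower incomplete Gamma integral `∫_0^1 e^{-ty} t^{a-1} dt`. -/
def lowerGamma (a y : ℝ) : ℝ :=
  ∫ t in Set.Ioc (0 : ℝ) 1, Real.exp (-(t * y)) * t ^ (a - 1)

/-- The upper incomplete Gamma integral `∫_R^∞ e^{-s} s^{a-1} ds`. -/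
def upperGamma (a R : ℝ) : ℝ :=
  ∫ s in Set.Ioi R, Real.exp (-s) * s ^ (a - 1)

lemma integrableOn_rpow_sub_one {a : ℝ} (ha : 0 < a) :
    IntegrableOn (fun t : ℝ => t ^ (a - 1)) (Set.Ioc 0 1) := by
  have := (intervalIntegral.intervalIntegrable_rpow' (a := 0) (b := 1) (r := a - 1) (by linarith)).1
  simpa using this

lemma integrableOn_lowerGamma {a : ℝ} (ha : 0 < a) (y : ℝ) :
    IntegrableOn (fun t : ℝ => Real.exp (-(t * y)) * t ^ (a - 1)) (Set.Ioc 0 1) := by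
  refine ((integrableOn_rpow_sub_one ha).const_mul (Real.exp |y|)).mono'
    (by fun_prop) ?_
  refine (ae_restrict_iff' measurableSet_Ioc).2 (.of_forall fun t ht => ?_)
  have h0 : 0 ≤ t ^ (a - 1) := Real.rpow_nonneg ht.1.le _
  rw [Real.norm_of_nonneg (by positivity)]
  gcongr
  have := neg_abs_le y
  have := abs_nonneg y
  nlinarith [ht.1, ht.2]

lemma lowerGamma_pos {a : ℝ} (ha : 0 < a) (y : ℝ) : 0 < lowerGamma a y := by
  refine (setIntegral_pos_iff_support_of_nonneg_ae ?_ (integrableOn_lowerGamma ha y)).2 ?_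
  · refine (ae_restrict_iff' measurableSet_Ioc).2 (.of_forall fun t ht => ?_)
    have h0 : 0 ≤ t ^ (a - 1) := Real.rpow_nonneg ht.1.le _
    simp only [Pi.zero_apply]
    positivity
  · have : Set.Ioc (0 : ℝ) 1 ⊆
        (Function.support fun t : ℝ => Real.exp (-(t * y)) * t ^ (a - 1)) ∩ Set.Ioc 0 1 := by
      refine fun t ht => ⟨?_, ht⟩
      have h0 : 0 < t ^ (a - 1) := Real.rpow_pos_of_pos ht.1 _
      simp only [Function.mem_support]
      positivity
    refine lt_of_lt_of_le ?_ (measure_mono this)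
    simp

lemma lowerGamma_le {a : ℝ} (ha : 0 < a) {y : ℝ} (hy : 0 ≤ y) :
    lowerGamma a y ≤ lowerGamma a 0 := by
  refine setIntegral_mono_on (integrableOn_lowerGamma ha y) (integrableOn_lowerGamma ha 0)
    measurableSet_Ioc fun t ht => ?_
  have h0 : 0 ≤ t ^ (a - 1) := Real.rpow_nonneg ht.1.le _
  gcongr
  nlinarith [ht.1]

/-- Differentiating under the integral brings down a factor `-t`, which raises the parameter by one
and stays in the same family. Iterating over all parameters gives smoothness of every order. -/
lemma hasDerivAt_lowerGamma {a : ℝ} (ha : 0 < a) (y : ℝ) :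
    HasDerivAt (lowerGamma a) (-lowerGamma (a + 1) y) y := by
  have key := (hasDerivAt_integral_of_dominated_loc_of_deriv_le
    (μ := volume.restrict (Set.Ioc (0 : ℝ) 1)) (x₀ := y) (s := Metric.ball y 1)
    (F := fun y t => Real.exp (-(t * y)) * t ^ (a - 1))
    (F' := fun y t => -(Real.exp (-(t * y)) * t ^ (a + 1 - 1)))
    (bound := fun t => Real.exp (|y| + 1) * t ^ (a - 1))
    (Metric.ball_mem_nhds _ one_pos) (.of_forall fun z => (by fun_prop))
    (integrableOn_lowerGamma ha y) (by fun_prop) ?_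
    ((integrableOn_rpow_sub_one ha).const_mul _) ?_).2
  · rw [integral_neg] at key
    exact key
  · refine (ae_restrict_iff' measurableSet_Ioc).2 (.of_forall fun t ht z hz => ?_)
    have h0 : 0 ≤ t ^ (a - 1) := Real.rpow_nonneg ht.1.le _
    have h1 : t ^ (a + 1 - 1) = t * t ^ (a - 1) := by
      rw [show a + 1 - 1 = 1 + (a - 1) by ring, Real.rpow_add ht.1, Real.rpow_one]
    rw [norm_neg, h1, Real.norm_of_nonneg (by have := ht.1; positivity)]
    have hz' : |z - y| < 1 := by simpa [Real.dist_eq] using hz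
    have h2 : |z| ≤ |y| + 1 := by
      have := abs_add_le (z - y) y
      simp only [sub_add_cancel] at this
      linarith
    gcongr
    · exact mul_nonneg ht.1.le h0
    · have h3 := mul_le_mul_of_nonneg_left (neg_abs_le z) ht.1.le
      have h4 := mul_le_mul_of_nonneg_right ht.2 (abs_nonneg z)
      linarith
    · exact mul_le_of_le_one_left h0 ht.2
  · refine (ae_restrict_iff' measurableSet_Ioc).2 (.of_forall fun t ht z _ => ?_)
    have h1 : t ^ (a + 1 - 1) = t * t ^ (a - 1) := by
      rw [show a + 1 - 1 = 1 + (a - 1) by ring, Real.rpow_add ht.1, Real.rpow_one]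
    have h2 : HasDerivAt (fun z : ℝ => -(t * z)) (-t) z := by
      simpa using ((hasDerivAt_id z).const_mul t).fun_neg
    convert! h2.exp.mul_const (t ^ (a - 1)) using 1
    rw [h1]
    ring

lemma contDiff_lowerGamma (n : ℕ) : ∀ {a : ℝ}, 0 < a → ContDiff ℝ n (lowerGamma a) := by
  induction n with
  | zero =>
    intro a ha
    exact contDiff_zero.2 (Differentiable.continuous
      fun y => (hasDerivAt_lowerGamma ha y).differentiableAt)
  | succ n ih =>
    intro a ha
    rw [Nat.cast_add, Nat.cast_one, contDiff_succ_iff_deriv]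
    refine ⟨fun y => (hasDerivAt_lowerGamma ha y).differentiableAt, by simp, ?_⟩
    have : deriv (lowerGamma a) = fun y => -lowerGamma (a + 1) y :=
      funext fun y => (hasDerivAt_lowerGamma ha y).deriv
    rw [this]
    exact (ih (by linarith)).neg

lemma integrableOn_upperGamma {a : ℝ} (ha : 0 < a) {R : ℝ} (hR : 0 ≤ R) :
    IntegrableOn (fun s : ℝ => Real.exp (-s) * s ^ (a - 1)) (Set.Ioi R) :=
  (Real.GammaIntegral_convergent ha).mono_set (Set.Ioi_subset_Ioi hR)

lemma upperGamma_pos {a : ℝ} (ha : 0 < a) {R : ℝ} (hR : 0 ≤ R) : 0 < upperGamma a R := by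
  refine (setIntegral_pos_iff_support_of_nonneg_ae ?_ (integrableOn_upperGamma ha hR)).2 ?_
  · refine (ae_restrict_iff' measurableSet_Ioi).2 (.of_forall fun t ht => ?_)
    have h0 : 0 ≤ t ^ (a - 1) := Real.rpow_nonneg (hR.trans ht.le) _
    simp only [Pi.zero_apply]
    positivity
  · have : Set.Ioi R ⊆
        (Function.support fun t : ℝ => Real.exp (-t) * t ^ (a - 1)) ∩ Set.Ioi R := by
      refine fun t ht => ⟨?_, ht⟩
      have h0 : 0 < t ^ (a - 1) := Real.rpow_pos_of_pos (hR.trans_lt ht) _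
      simp only [Function.mem_support]
      positivity
    refine lt_of_lt_of_le ?_ (measure_mono this)
    simp

lemma upperGamma_anti {a : ℝ} (ha : 0 < a) {R S : ℝ} (hR : 0 ≤ R) (hRS : R ≤ S) :
    upperGamma a S ≤ upperGamma a R := by
  refine setIntegral_mono_set (integrableOn_upperGamma ha hR) ?_
    (Set.Ioi_subset_Ioi hRS).eventuallyLE
  refine (ae_restrict_iff' measurableSet_Ioi).2 (.of_forall fun t ht => ?_)
  have h0 : 0 ≤ t ^ (a - 1) := Real.rpow_nonneg (hR.trans ht.le) _
  simp only [Pi.zero_apply]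
  positivity

/-- On `s > R` one may insert the factor `(s/R)^b ≥ 1`. The exponent `b` is free, so the tail decays
faster than any power. -/
lemma upperGamma_le {a b : ℝ} (ha : 0 < a) (hb : 0 ≤ b) {R : ℝ} (hR : 0 < R) :
    upperGamma a R ≤ R ^ (-b) * Real.Gamma (a + b) := by
  have h1 : upperGamma a R ≤ R ^ (-b) * upperGamma (a + b) R := by
    rw [upperGamma, upperGamma, ← integral_const_mul]
    refine setIntegral_mono_on (integrableOn_upperGamma ha hR.le)
      ((integrableOn_upperGamma (by linarith) hR.le).const_mul _) measurableSet_Ioi fun t ht => ?_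
    have ht0 : 0 < t := hR.trans ht
    have h2 : t ^ (a + b - 1) = t ^ b * t ^ (a - 1) := by
      rw [← Real.rpow_add ht0]
      ring_nf
    have h3 : 1 ≤ R ^ (-b) * t ^ b := by
      rw [Real.rpow_neg hR.le, ← div_eq_inv_mul, one_le_div (by positivity)]
      exact Real.rpow_le_rpow hR.le ht.le hb
    rw [h2]
    calc Real.exp (-t) * t ^ (a - 1) = 1 * (Real.exp (-t) * t ^ (a - 1)) := by ring
      _ ≤ (R ^ (-b) * t ^ b) * (Real.exp (-t) * t ^ (a - 1)) := by gcongr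
      _ = _ := by ring
  refine h1.trans ?_
  gcongr
  rw [Real.Gamma_eq_integral (by linarith)]
  exact upperGamma_anti (by linarith) le_rfl hR.le

/-- The substitution `s = t y` turns `y^{-a} upperGamma a y` into the tail over `t > 1` of `∫_0^∞
e^{-ty} t^{a-1} dt`, of which `lowerGamma` is the part `t ≤ 1`. -/
lemma lowerGamma_add_upperGamma {a : ℝ} (ha : 0 < a) {y : ℝ} (hy : 0 < y) :
    lowerGamma a y + y ^ (-a) * upperGamma a y = y ^ (-a) * Real.Gamma a := by
  have h1 : upperGamma a y = y * ∫ t in Set.Ioi (1 : ℝ), Real.exp (-(y * t)) * (y * t) ^ (a - 1) := by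
    have := integral_comp_mul_left_Ioi' (fun s => Real.exp (-s) * s ^ (a - 1)) 1 hy
    simp only [mul_one, smul_eq_mul] at this
    rw [upperGamma, ← this]
  have h2 : y ^ (-a) * upperGamma a y =
      ∫ t in Set.Ioi (1 : ℝ), Real.exp (-(t * y)) * t ^ (a - 1) := by
    rw [h1, ← mul_assoc, ← integral_const_mul]
    refine setIntegral_congr_fun measurableSet_Ioi fun t ht => ?_
    have ht0 : (0 : ℝ) < t := one_pos.trans ht
    rw [Real.mul_rpow hy.le ht0.le, mul_comm y t]
    have : y ^ (-a) * y * y ^ (a - 1) = 1 := by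
      nth_rewrite 2 [← Real.rpow_one y]
      rw [← Real.rpow_add hy, ← Real.rpow_add hy]
      ring_nf
      exact Real.rpow_zero _
    linear_combination (Real.exp (-(t * y)) * t ^ (a - 1)) * this
  have h3 := Real.integral_rpow_mul_exp_neg_mul_Ioi ha hy
  have hint : IntegrableOn (fun t : ℝ => Real.exp (-(t * y)) * t ^ (a - 1)) (Set.Ioi 1) := by
    have h4 := (integrableOn_Ioi_comp_mul_left_iff
      (fun s => Real.exp (-s) * s ^ (a - 1)) 1 hy).2
      (integrableOn_upperGamma ha (by simpa using hy.le))
    refine IntegrableOn.congr_fun (h4.const_mul (y ^ (-(a - 1)))) (fun t ht => ?_) measurableSet_Ioi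
    have ht0 : (0 : ℝ) < t := one_pos.trans ht
    rw [Real.mul_rpow hy.le ht0.le, mul_comm y t]
    have : y ^ (-(a - 1)) * y ^ (a - 1) = 1 := by
      rw [← Real.rpow_add hy]
      simp
    linear_combination (Real.exp (-(t * y)) * t ^ (a - 1)) * this
  rw [h2, lowerGamma, ← setIntegral_union (Set.Ioc_disjoint_Ioi le_rfl) measurableSet_Ioi
    (integrableOn_lowerGamma ha y) hint, Set.Ioc_union_Ioi_eq_Ioi zero_le_one,
    Real.rpow_neg hy.le, ← Real.inv_rpow hy.le, ← one_div, ← h3]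
  exact setIntegral_congr_fun measurableSet_Ioi fun t _ => by rw [mul_comm t y, mul_comm]

/-! ### Splitting the power potential into a regular and a singular part. -/

/-- The part of `|x|^{-k} = Γ(k/2)⁻¹ ∫_0^∞ e^{-t|x|²} t^{k/2-1} dt` coming from `t ≤ 1`. -/
def regularPart (d : ℕ) (k : ℝ) (x : EuclideanSpace ℝ (Fin d)) : ℝ :=
  (Real.Gamma (k / 2))⁻¹ * lowerGamma (k / 2) (‖x‖ ^ 2)

/-- The remainder `|x|^{-k} - regularPart d k x`, which comes from `t > 1`. -/
def singularPart (d : ℕ) (k : ℝ) (x : EuclideanSpace ℝ (Fin d)) : ℝ :=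
  powerPotential d k x - regularPart d k x

lemma powerPotential_eq (d : ℕ) (k : ℝ) (x : EuclideanSpace ℝ (Fin d)) :
    powerPotential d k x = ‖x‖ ^ (-k) := by
  rw [powerPotential, Real.rpow_neg (norm_nonneg _), one_div]

lemma powerPotential_nonneg (d : ℕ) (k : ℝ) (x : EuclideanSpace ℝ (Fin d)) :
    0 ≤ powerPotential d k x := by
  unfold powerPotential
  positivity

lemma powerPotential_zero (d : ℕ) {k : ℝ} (hk : 0 < k) : powerPotential d k 0 = 0 := by
  simp [powerPotential, Real.zero_rpow hk.ne']

lemma measurable_powerPotential (d : ℕ) (k : ℝ) : Measurable (powerPotential d k) := by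
  unfold powerPotential
  fun_prop

lemma contDiff_regularPart (d : ℕ) {k : ℝ} (hk : 0 < k) (n : ℕ) :
    ContDiff ℝ n (regularPart d k) :=
  contDiff_const.mul ((contDiff_lowerGamma n (by linarith)).comp (contDiff_norm_sq ℝ))

lemma continuous_regularPart (d : ℕ) {k : ℝ} (hk : 0 < k) : Continuous (regularPart d k) :=
  (contDiff_regularPart d hk 0).continuous

lemma measurable_singularPart (d : ℕ) {k : ℝ} (hk : 0 < k) : Measurable (singularPart d k) :=
  (measurable_powerPotential d k).sub (continuous_regularPart d hk).measurable

lemma regularPart_pos (d : ℕ) {k : ℝ} (hk : 0 < k) (x : EuclideanSpace ℝ (Fin d)) :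
    0 < regularPart d k x :=
  mul_pos (inv_pos.2 (Real.Gamma_pos_of_pos (by linarith))) (lowerGamma_pos (by linarith) _)

lemma regularPart_le (d : ℕ) {k : ℝ} (hk : 0 < k) (x : EuclideanSpace ℝ (Fin d)) :
    regularPart d k x ≤ regularPart d k 0 := by
  unfold regularPart
  have := Real.Gamma_pos_of_pos (half_pos hk)
  gcongr
  simpa using lowerGamma_le (half_pos hk) (sq_nonneg ‖x‖)

/-- The ratio of the singular part to the potential is a positive decreasing function of the radius;
the upper and lower bounds below are read off from it. -/
lemma singularPart_eq (d : ℕ) {k : ℝ} (hk : 0 < k) {x : EuclideanSpace ℝ (Fin d)} (hx : x ≠ 0) :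
    singularPart d k x =
      (Real.Gamma (k / 2))⁻¹ * upperGamma (k / 2) (‖x‖ ^ 2) * powerPotential d k x := by
  have hx' : 0 < ‖x‖ := norm_pos_iff.2 hx
  have h := lowerGamma_add_upperGamma (half_pos hk) (y := ‖x‖ ^ 2) (by positivity)
  have hG := Real.Gamma_pos_of_pos (half_pos hk)
  have h1 : (‖x‖ ^ 2) ^ (-(k / 2)) = ‖x‖ ^ (-k) := by
    rw [← Real.rpow_natCast, ← Real.rpow_mul hx'.le]
    congr 1
    push_cast
    ring
  rw [h1] at h
  rw [singularPart, regularPart, powerPotential_eq]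
  field_simp
  linarith

lemma singularPart_nonneg (d : ℕ) {k : ℝ} (hk : 0 < k) {x : EuclideanSpace ℝ (Fin d)}
    (hx : x ≠ 0) : 0 ≤ singularPart d k x := by
  rw [singularPart_eq d hk hx]
  have := Real.Gamma_pos_of_pos (half_pos hk)
  have := upperGamma_pos (half_pos hk) (sq_nonneg ‖x‖)
  have := powerPotential_nonneg d k x
  positivity

lemma singularPart_le (d : ℕ) {k b : ℝ} (hk : 0 < k) (hb : 0 ≤ b)
    {x : EuclideanSpace ℝ (Fin d)} (hx : x ≠ 0) :
    singularPart d k x ≤ Real.Gamma (k / 2 + b) / Real.Gamma (k / 2) * ‖x‖ ^ (-(k + 2 * b)) := by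
  have hx' : 0 < ‖x‖ := norm_pos_iff.2 hx
  have hG := Real.Gamma_pos_of_pos (half_pos hk)
  have h := upperGamma_le (half_pos hk) hb (R := ‖x‖ ^ 2) (by positivity)
  have h1 : (‖x‖ ^ 2) ^ (-b) = ‖x‖ ^ (-(2 * b)) := by
    rw [← Real.rpow_natCast, ← Real.rpow_mul hx'.le]
    congr 1
    push_cast
    ring
  have h2 : ‖x‖ ^ (-(k + 2 * b)) = ‖x‖ ^ (-(2 * b)) * ‖x‖ ^ (-k) := by
    rw [← Real.rpow_add hx']
    ring_nf
  rw [h1] at h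
  rw [singularPart_eq d hk hx, powerPotential_eq, h2]
  calc (Real.Gamma (k / 2))⁻¹ * upperGamma (k / 2) (‖x‖ ^ 2) * ‖x‖ ^ (-k)
      ≤ (Real.Gamma (k / 2))⁻¹ * (‖x‖ ^ (-(2 * b)) * Real.Gamma (k / 2 + b)) * ‖x‖ ^ (-k) := by
        gcongr
    _ = _ := by ring

/-- The ratio is radially decreasing, so on a ball it is bounded below by its value at radius `R`.
This is what lets the remainder control the full potential near the diagonal. -/
lemma exists_le_singularPart (d : ℕ) {k : ℝ} (hk : 0 < k) (R : ℝ) :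
    ∃ c > 0, ∀ x : EuclideanSpace ℝ (Fin d), x ≠ 0 → ‖x‖ ≤ R →
      c * powerPotential d k x ≤ singularPart d k x := by
  have hG := Real.Gamma_pos_of_pos (half_pos hk)
  refine ⟨(Real.Gamma (k / 2))⁻¹ * upperGamma (k / 2) (R ^ 2),
    mul_pos (inv_pos.2 hG) (upperGamma_pos (half_pos hk) (sq_nonneg _)), fun x hx hxR => ?_⟩
  rw [singularPart_eq d hk hx]
  have := powerPotential_nonneg d k x
  gcongr
  exact upperGamma_anti (half_pos hk) (sq_nonneg _) (by gcongr)

/-! ### Integrability and scaling in `L^p`. -/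

lemma memLp_min_norm_rpow {d : ℕ} (hd : 0 < d) {a b p : ℝ} (hp : 0 < p) (ha : a * p < d)
    (hb : d < b * p) :
    MemLp (fun x : EuclideanSpace ℝ (Fin d) => min (‖x‖ ^ (-a)) (‖x‖ ^ (-b)))
      (ENNReal.ofReal p) volume := by
  have : NeZero d := ⟨hd.ne'⟩
  have hp0 : ENNReal.ofReal p ≠ 0 := by simpa using hp
  rw [← integrable_norm_rpow_iff (by fun_prop) hp0 ENNReal.ofReal_ne_top,
    ENNReal.toReal_ofReal hp.le]
  refine (integrable_fun_norm_addHaar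
    (f := fun r : ℝ => ‖min (r ^ (-a)) (r ^ (-b))‖ ^ p) volume).2 ?_
  rw [finrank_euclideanSpace_fin, ← Set.Ioc_union_Ioi_eq_Ioi (zero_le_one' ℝ)]
  -- In polar coordinates either power may be used as a bound: the exponent `a` is integrable up to
  -- radius `1`, the exponent `b` beyond it.
  have key : ∀ y : ℝ, 0 < y → ∀ s : ℝ, min (y ^ (-a)) (y ^ (-b)) ≤ y ^ (-s) →
      ‖y ^ (d - 1) • ‖min (y ^ (-a)) (y ^ (-b))‖ ^ p‖ ≤ y ^ ((d : ℝ) - 1 - s * p) := by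
    intro y hy s hs
    have h0 : 0 ≤ min (y ^ (-a)) (y ^ (-b)) := by positivity
    rw [Real.norm_of_nonneg h0, Real.norm_of_nonneg (by positivity), smul_eq_mul]
    calc y ^ (d - 1) * min (y ^ (-a)) (y ^ (-b)) ^ p ≤ y ^ (d - 1) * (y ^ (-s)) ^ p := by gcongr
      _ = y ^ ((d : ℝ) - 1 - s * p) := by
        rw [← Real.rpow_natCast, ← Real.rpow_mul hy.le, ← Real.rpow_add hy, Nat.cast_sub hd]
        push_cast
        ring_nf
  refine IntegrableOn.union ?_ ?_
  · refine Integrable.mono' (g := fun y => y ^ ((d : ℝ) - 1 - a * p)) ?_ (by fun_prop) ?_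
    · have := (intervalIntegral.intervalIntegrable_rpow' (a := 0) (b := 1)
        (r := (d : ℝ) - 1 - a * p) (by linarith)).1
      simpa [IntegrableOn] using this
    · exact (ae_restrict_iff' measurableSet_Ioc).2
        (.of_forall fun y hy => key y hy.1 a (min_le_left _ _))
  · refine Integrable.mono' (g := fun y => y ^ ((d : ℝ) - 1 - b * p)) ?_ (by fun_prop) ?_
    · exact integrableOn_Ioi_rpow_of_lt (by linarith) one_pos
    · exact (ae_restrict_iff' measurableSet_Ioi).2
        (.of_forall fun y hy => key y (one_pos.trans hy) b (min_le_right _ _))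

lemma ae_ne_zero {d : ℕ} (hd : 0 < d) : ∀ᵐ x : EuclideanSpace ℝ (Fin d), x ≠ 0 := by
  have : NeZero d := ⟨hd.ne'⟩
  exact Measure.ae_ne volume 0

/-- The tail estimate with `b = 0` handles the origin, and with `b = d` it gives decay
`|x|^{-(k+2d)}`, integrable to every power `p ≥ 1`. -/
lemma memLp_singularPart {d : ℕ} (hd : 0 < d) {k p : ℝ} (hk : 0 < k) (hp : 1 ≤ p)
    (hkp : k * p < d) : MemLp (singularPart d k) (ENNReal.ofReal p) volume := by
  have hd' : (0 : ℝ) < d := by exact_mod_cast hd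
  have hG := Real.Gamma_pos_of_pos (half_pos hk)
  refine (memLp_min_norm_rpow hd (a := k) (b := k + 2 * d) (by linarith) hkp
    (by nlinarith)).of_le_mul (c := max 1 (Real.Gamma (k / 2 + d) / Real.Gamma (k / 2)))
    (measurable_singularPart d hk).aestronglyMeasurable ?_
  filter_upwards [ae_ne_zero hd] with x hx
  have h0 : 0 ≤ min (‖x‖ ^ (-k)) (‖x‖ ^ (-(k + 2 * d))) := by positivity
  rw [Real.norm_of_nonneg (singularPart_nonneg d hk hx), Real.norm_of_nonneg h0]
  have h1 := singularPart_le d hk le_rfl hx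
  have h2 := singularPart_le d hk hd'.le hx
  simp only [add_zero, mul_zero, div_self hG.ne', one_mul] at h1
  rcases min_choice (‖x‖ ^ (-k)) (‖x‖ ^ (-(k + 2 * d))) with h | h <;> rw [h]
  · exact h1.trans (le_mul_of_one_le_left (by positivity) (le_max_left _ _))
  · exact h2.trans (by gcongr; exact le_max_right _ _)

lemma integrable_singularPart {d : ℕ} {k : ℝ} (hk : 0 < k) (hkd : k < d) :
    Integrable (singularPart d k) := by
  have hd : 0 < d := by
    have : (0 : ℝ) < d := by linarith
    exact_mod_cast this
  rw [← memLp_one_iff_integrable, ← ENNReal.ofReal_one]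
  exact memLp_singularPart hd hk le_rfl (by linarith)

lemma eLpNorm_comp_inv_smul {d : ℕ} (f : EuclideanSpace ℝ (Fin d) → ℝ) {p ε : ℝ} (hp : 0 < p)
    (hε : 0 < ε) :
    eLpNorm (fun x => f (ε⁻¹ • x)) (ENNReal.ofReal p) volume =
      ENNReal.ofReal (ε ^ (d / p)) * eLpNorm f (ENNReal.ofReal p) volume := by
  have hemb : MeasurableEmbedding (fun x : EuclideanSpace ℝ (Fin d) => ε⁻¹ • x) :=
    (Homeomorph.smulOfNeZero ε⁻¹ (inv_ne_zero hε.ne')).measurableEmbedding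
  have h := hemb.eLpNorm_map_measure (μ := volume) (g := f) (p := ENNReal.ofReal p)
  have h2 : |((ε⁻¹) ^ d)⁻¹| = ε ^ d := by
    rw [inv_pow, inv_inv, abs_of_pos (by positivity)]
  have h3 : (ε ^ d) ^ (1 / p) = ε ^ (d / p) := by
    rw [← Real.rpow_natCast, ← Real.rpow_mul hε.le, mul_one_div]
  rw [Measure.map_addHaar_smul volume (inv_ne_zero hε.ne'), finrank_euclideanSpace_fin, h2,
    eLpNorm_smul_measure_of_ne_top ENNReal.ofReal_ne_top, ENNReal.toReal_div, ENNReal.toReal_one,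
    ENNReal.toReal_ofReal hp.le,
    ENNReal.ofReal_rpow_of_nonneg (by positivity) (by positivity), h3] at h
  exact h.symm

/-! ### The rescaled regularization. -/

/-- The regularization of `|x|^{-k}` at length scale `ε`: the rescaled `regularPart`. -/
def regularization (d : ℕ) (k ε : ℝ) (x : EuclideanSpace ℝ (Fin d)) : ℝ :=
  ε ^ (-k) * regularPart d k (ε⁻¹ • x)

lemma powerPotential_inv_smul {d : ℕ} {k ε : ℝ} (hε : 0 < ε) (x : EuclideanSpace ℝ (Fin d)) :
    ε ^ (-k) * powerPotential d k (ε⁻¹ • x) = powerPotential d k x := by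
  rw [powerPotential_eq, powerPotential_eq, norm_smul, Real.norm_of_nonneg (by positivity),
    Real.mul_rpow (by positivity) (norm_nonneg _), ← mul_assoc, ← Real.mul_rpow (by positivity)
    (by positivity), mul_inv_cancel₀ hε.ne', Real.one_rpow, one_mul]

lemma powerPotential_sub_regularization {d : ℕ} {k ε : ℝ} (hε : 0 < ε)
    (x : EuclideanSpace ℝ (Fin d)) :
    powerPotential d k x - regularization d k ε x = ε ^ (-k) * singularPart d k (ε⁻¹ • x) := by
  rw [← powerPotential_inv_smul hε, regularization, singularPart, mul_sub]

lemma contDiff_regularization (d : ℕ) {k : ℝ} (hk : 0 < k) (ε : ℝ) (n : ℕ) :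
    ContDiff ℝ n (regularization d k ε) :=
  contDiff_const.mul ((contDiff_regularPart d hk n).comp (contDiff_const_smul _))

lemma continuous_regularization (d : ℕ) {k : ℝ} (hk : 0 < k) (ε : ℝ) :
    Continuous (regularization d k ε) :=
  (contDiff_regularization d hk ε 0).continuous

lemma regularization_pos {d : ℕ} {k ε : ℝ} (hk : 0 < k) (hε : 0 < ε)
    (x : EuclideanSpace ℝ (Fin d)) : 0 < regularization d k ε x :=
  mul_pos (by positivity) (regularPart_pos d hk _)

lemma regularization_zero (d : ℕ) (k ε : ℝ) :
    regularization d k ε 0 = ε ^ (-k) * regularPart d k 0 := by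
  simp [regularization]

lemma regularization_le_zero {d : ℕ} {k ε : ℝ} (hk : 0 < k) (hε : 0 < ε)
    (x : EuclideanSpace ℝ (Fin d)) : regularization d k ε x ≤ regularization d k ε 0 := by
  rw [regularization_zero, regularization]
  have := regularPart_le d hk (ε⁻¹ • x)
  gcongr

lemma regularization_le_powerPotential {d : ℕ} {k ε : ℝ} (hk : 0 < k) (hε : 0 < ε)
    {x : EuclideanSpace ℝ (Fin d)} (hx : x ≠ 0) :
    regularization d k ε x ≤ powerPotential d k x := by
  have h := singularPart_nonneg d hk (smul_ne_zero (inv_ne_zero hε.ne') hx)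
  have h2 := powerPotential_sub_regularization (k := k) hε x
  have : 0 ≤ ε ^ (-k) * singularPart d k (ε⁻¹ • x) := by positivity
  linarith

lemma regularization_neg (d : ℕ) (k ε : ℝ) (x : EuclideanSpace ℝ (Fin d)) :
    regularization d k ε (-x) = regularization d k ε x := by
  simp [regularization, regularPart]

lemma eLpNorm_top_regularization {d : ℕ} {k ε : ℝ} (hk : 0 < k) (hε : 0 < ε) :
    eLpNorm (regularization d k ε) ∞ volume = ENNReal.ofReal (regularization d k ε 0) := by
  rw [eLpNorm_exponent_top]
  refine le_antisymm (eLpNormEssSup_le_of_ae_bound (.of_forall fun x => ?_)) ?_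
  · rw [Real.norm_of_nonneg (regularization_pos hk hε x).le]
    exact regularization_le_zero hk hε x
  -- By continuity the essential bound holds on a closed set of full measure, hence everywhere, in
  -- particular at the origin where the maximum is attained.
  · have hae := ae_le_eLpNormEssSup (f := regularization d k ε) (μ := volume)
    have hcl : IsClosed {x | ‖regularization d k ε x‖ₑ ≤
        eLpNormEssSup (regularization d k ε) volume} :=
      isClosed_le (continuous_regularization d hk ε).enorm continuous_const
    have huniv := (hcl.ae_eq_univ_iff_eq (μ := volume)).1 (by
      rw [Filter.eventuallyEq_univ]; exact hae)
    have h0 := huniv.ge (Set.mem_univ (0 : EuclideanSpace ℝ (Fin d)))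
    simpa [Real.enorm_of_nonneg (regularization_pos hk hε 0).le] using h0

lemma supNorm_regularization {d : ℕ} {k ε : ℝ} (hk : 0 < k) (hε : 0 < ε) :
    supNorm (regularization d k ε) = ε ^ (-k) * regularPart d k 0 := by
  rw [supNorm, eLpNorm_top_regularization hk hε,
    ENNReal.toReal_ofReal (regularization_pos hk hε 0).le, regularization_zero]

/-! ### Non-negativity of the Fourier transform. -/

lemma regularization_eq_integral (d : ℕ) (k ε : ℝ) (x : EuclideanSpace ℝ (Fin d)) :
    regularization d k ε x = ε ^ (-k) * (Real.Gamma (k / 2))⁻¹ *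
      ∫ t in Set.Ioc (0 : ℝ) 1, Real.exp (-((t * ε⁻¹ ^ 2) * ‖x‖ ^ 2)) * t ^ (k / 2 - 1) := by
  rw [regularization, regularPart, lowerGamma, mul_assoc, norm_smul, mul_pow, norm_inv,
    Real.norm_eq_abs]
  simp only [inv_pow, sq_abs, mul_assoc]

/-- The transform is moved from `φ` onto the Gaussian, whose own transform is a positive Gaussian.
-/
lemma integral_fourier_mul_gaussian_nonneg {d : ℕ} {φ : 𝓢(EuclideanSpace ℝ (Fin d), ℂ)}
    (hφ : ∀ ξ, 0 ≤ φ ξ) {b : ℝ} (hb : 0 < b) :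
    0 ≤ ∫ x, (𝓕 φ) x * (Real.exp (-(b * ‖x‖ ^ 2)) : ℂ) := by
  have hbc : 0 < (b : ℂ).re := by simpa using hb
  have hint : Integrable fun x : EuclideanSpace ℝ (Fin d) => Complex.exp (-b * ‖x‖ ^ 2) := by
    simpa using GaussianFourier.integrable_cexp_neg_mul_sq_norm_add hbc 0
      (0 : EuclideanSpace ℝ (Fin d))
  have h := VectorFourier.integral_fourierIntegral_smul_eq_flip
    (L := innerₗ (EuclideanSpace ℝ (Fin d))) Real.continuous_fourierChar continuous_inner
    (φ.integrable (μ := volume)) hint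
  have h2 : ∫ x, (𝓕 φ) x * (Real.exp (-(b * ‖x‖ ^ 2)) : ℂ) =
      ∫ x, φ x • 𝓕 (fun x : EuclideanSpace ℝ (Fin d) => Complex.exp (-b * ‖x‖ ^ 2)) x := by
    simpa using! h
  rw [h2]
  refine integral_nonneg fun x => ?_
  simp only [fourier_gaussian_innerProductSpace hbc, Pi.zero_apply, smul_eq_mul]
  refine mul_nonneg (hφ x) ?_
  have h3 : ((Real.pi : ℂ) / b) ^ (Module.finrank ℝ (EuclideanSpace ℝ (Fin d)) / 2 : ℂ) *
      Complex.exp (-Real.pi ^ 2 * ‖x‖ ^ 2 / b) =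
      (((Real.pi / b) ^ (Module.finrank ℝ (EuclideanSpace ℝ (Fin d)) / 2 : ℝ) *
        Real.exp (-Real.pi ^ 2 * ‖x‖ ^ 2 / b) : ℝ) : ℂ) := by
    push_cast
    rw [Complex.ofReal_cpow (by positivity)]
    push_cast
    rfl
  rw [h3]
  exact Complex.zero_le_real.2 (by positivity)

/-- Fubini exchanges the test integral with the Gaussian mixture, reducing to one Gaussian for each
`t`. The product is dominated by `‖𝓕 φ‖ · t^{k/2-1}`. -/
lemma fourierNonneg_regularization {d : ℕ} {k ε : ℝ} (hk : 0 < k) (hε : 0 < ε) :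
    FourierNonneg (regularization d k ε) := by
  intro φ hφ
  have hG := Real.Gamma_pos_of_pos (half_pos hk)
  have h1 : ∀ x : EuclideanSpace ℝ (Fin d), (𝓕 φ) x * (regularization d k ε x : ℂ) =
      ((ε ^ (-k) * (Real.Gamma (k / 2))⁻¹ : ℝ) : ℂ) *
        ∫ t in Set.Ioc (0 : ℝ) 1, (𝓕 φ) x *
          ((Real.exp (-((t * ε⁻¹ ^ 2) * ‖x‖ ^ 2)) * t ^ (k / 2 - 1) : ℝ) : ℂ) := by
    intro x
    rw [regularization_eq_integral, Complex.ofReal_mul, ← integral_complex_ofReal,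
      integral_const_mul]
    ring
  simp_rw [h1]
  rw [integral_const_mul, integral_integral_swap]
  · refine mul_nonneg (Complex.zero_le_real.2 (by positivity)) ?_
    refine integral_nonneg_of_ae ((ae_restrict_iff' measurableSet_Ioc).2 (.of_forall
      fun t ht => ?_))
    have h2 : ∀ x : EuclideanSpace ℝ (Fin d), (𝓕 φ) x *
        ((Real.exp (-((t * ε⁻¹ ^ 2) * ‖x‖ ^ 2)) * t ^ (k / 2 - 1) : ℝ) : ℂ) =
        (𝓕 φ) x * (Real.exp (-((t * ε⁻¹ ^ 2) * ‖x‖ ^ 2)) : ℂ) * ((t ^ (k / 2 - 1) : ℝ) : ℂ) := by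
      intro x
      rw [Complex.ofReal_mul]
      exact (mul_assoc _ _ _).symm
    simp_rw [h2]
    rw [Pi.zero_apply, integral_mul_const]
    have ht0 := ht.1
    exact mul_nonneg (integral_fourier_mul_gaussian_nonneg hφ (by positivity))
      (Complex.zero_le_real.2 (by positivity))
  · refine Integrable.mono' (((𝓕 φ).integrable (μ := volume)).norm.mul_prod
      (integrableOn_rpow_sub_one (half_pos hk))) ?_ ?_
    · refine AEStronglyMeasurable.mul
        ((𝓕 φ).continuous.comp continuous_fst).aestronglyMeasurable ?_
      exact (by fun_prop : Measurable fun z : EuclideanSpace ℝ (Fin d) × ℝ =>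
        ((Real.exp (-((z.2 * ε⁻¹ ^ 2) * ‖z.1‖ ^ 2)) * z.2 ^ (k / 2 - 1) : ℝ) : ℂ)).aestronglyMeasurable
    · have hmem : ∀ᵐ z ∂((volume : Measure (EuclideanSpace ℝ (Fin d))).prod
          (volume.restrict (Set.Ioc (0 : ℝ) 1))), z.2 ∈ Set.Ioc (0 : ℝ) 1 :=
        Measure.quasiMeasurePreserving_snd.ae (ae_restrict_mem measurableSet_Ioc)
      filter_upwards [hmem] with z hz
      have hz0 := hz.1
      have h0 : 0 ≤ z.2 ^ (k / 2 - 1) := by positivity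
      simp only [Function.uncurry_def, norm_mul, Complex.norm_real]
      rw [Real.norm_of_nonneg (Real.exp_pos _).le, Real.norm_of_nonneg h0]
      gcongr
      refine mul_le_of_le_one_left h0 (Real.exp_le_one_iff.2 ?_)
      have : 0 ≤ z.2 * ε⁻¹ ^ 2 * ‖z.1‖ ^ 2 := by positivity
      linarith

/-! ### Approximation bounds in `L^p + L^q`. -/

lemma sumNorm_le_left {d : ℕ} {p q : ℝ} {f : EuclideanSpace ℝ (Fin d) → ℝ}
    (hf : MemLp f (ENNReal.ofReal p) volume) :
    sumNorm p q f ≤ eLpNorm f (ENNReal.ofReal p) volume := by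
  have h : sumNorm p q f ≤ eLpNorm f (ENNReal.ofReal p) volume +
      eLpNorm (0 : EuclideanSpace ℝ (Fin d) → ℝ) (ENNReal.ofReal q) volume :=
    iInf_le_of_le f <| iInf_le_of_le 0 <| iInf_le_of_le hf <|
      iInf_le_of_le MemLp.zero <| iInf_le_of_le (by simp) le_rfl
  simpa using h

lemma sumNorm_le_right {d : ℕ} {p q : ℝ} {f : EuclideanSpace ℝ (Fin d) → ℝ}
    (hf : MemLp f (ENNReal.ofReal q) volume) :
    sumNorm p q f ≤ eLpNorm f (ENNReal.ofReal q) volume := by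
  have h : sumNorm p q f ≤ eLpNorm (0 : EuclideanSpace ℝ (Fin d) → ℝ) (ENNReal.ofReal p) volume +
      eLpNorm f (ENNReal.ofReal q) volume :=
    iInf_le_of_le 0 <| iInf_le_of_le f <| iInf_le_of_le MemLp.zero <|
      iInf_le_of_le hf <| iInf_le_of_le (by simp) le_rfl
  simpa using h

lemma sumNorm_regularization_sub_le {d : ℕ} (hd : 0 < d) {k p ε : ℝ} (q : ℝ) (hk : 0 < k)
    (hp : 1 ≤ p) (hkp : k * p < d) (hε : 0 < ε) :
    sumNorm p q (fun x => regularization d k ε x - powerPotential d k x) ≤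
      ENNReal.ofReal (ε ^ (d / p - k) *
        (eLpNorm (singularPart d k) (ENNReal.ofReal p) volume).toReal) := by
  have hU := memLp_singularPart hd hk hp hkp
  have hp0 : 0 < p := by linarith
  have hfun : (fun x => regularization d k ε x - powerPotential d k x) =
      fun x => (-(ε ^ (-k))) • singularPart d k (ε⁻¹ • x) := by
    funext x
    have := powerPotential_sub_regularization (k := k) hε x
    rw [smul_eq_mul]
    linarith
  have hn : eLpNorm (fun x => regularization d k ε x - powerPotential d k x)
      (ENNReal.ofReal p) volume = ENNReal.ofReal (ε ^ (d / p - k) *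
        (eLpNorm (singularPart d k) (ENNReal.ofReal p) volume).toReal) := by
    rw [hfun]
    refine (eLpNorm_const_smul (-(ε ^ (-k))) (fun x => singularPart d k (ε⁻¹ • x)) _ _).trans ?_
    rw [eLpNorm_comp_inv_smul _ hp0 hε, ENNReal.ofReal_mul (by positivity),
      ENNReal.ofReal_toReal hU.eLpNorm_ne_top, enorm_neg, Real.enorm_of_nonneg (by positivity),
      ← mul_assoc, ← ENNReal.ofReal_mul (by positivity), ← Real.rpow_add hε]
    ring_nf
  rw [← hn]
  refine sumNorm_le_left ⟨?_, by rw [hn]; exact ENNReal.ofReal_lt_top⟩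
  exact ((continuous_regularization d hk ε).measurable.sub
    (measurable_powerPotential d k)).aestronglyMeasurable

/-- Since the cutoff vanishes for `|x| < δ`, the product is dominated by a profile at scale `δ` that
is bounded at the origin. Tail decay with `b = 1/2` leaves exactly one power of `ε` and the rate
`|x|^{-(k+1)}`, which lies in `L^q` at infinity. -/
lemma norm_rescale_mul_le {d : ℕ} {k ε δ : ℝ} {ζ : EuclideanSpace ℝ (Fin d) → ℝ}
    (hζ : IsCutoff d ζ) (hk : 0 < k) (hε : 0 < ε) (hδ : 0 < δ) (x : EuclideanSpace ℝ (Fin d)) :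
    ‖rescale ζ δ x * (regularization d k ε x - powerPotential d k x)‖ ≤
      (Real.Gamma (k / 2 + 1 / 2) / Real.Gamma (k / 2) * ε * δ ^ (-(k + 1))) *
        ‖min (‖δ⁻¹ • x‖ ^ (-(0 : ℝ))) (‖δ⁻¹ • x‖ ^ (-(k + 1)))‖ := by
  have hG := Real.Gamma_pos_of_pos (half_pos hk)
  have hG' := Real.Gamma_pos_of_pos (show 0 < k / 2 + 1 / 2 by linarith)
  by_cases hx : δ⁻¹ • x ∈ Metric.ball (0 : EuclideanSpace ℝ (Fin d)) 1
  · rw [rescale, hζ.eq_zero _ hx, zero_mul, norm_zero]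
    positivity
  have hx1 : 1 ≤ ‖δ⁻¹ • x‖ := by simpa using hx
  have hx0 : x ≠ 0 := by
    rintro rfl
    simp at hx1
    linarith
  have hx0' : 0 < ‖x‖ := norm_pos_iff.2 hx0
  have hmin : min (‖δ⁻¹ • x‖ ^ (-(0 : ℝ))) (‖δ⁻¹ • x‖ ^ (-(k + 1))) = ‖δ⁻¹ • x‖ ^ (-(k + 1)) :=
    min_eq_right (Real.rpow_le_rpow_of_exponent_le hx1 (by linarith))
  have hscale : ∀ {a s : ℝ}, 0 < a → ‖a⁻¹ • x‖ ^ (-s) = a ^ s * ‖x‖ ^ (-s) := by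
    intro a s ha
    rw [norm_smul, norm_inv, Real.norm_of_nonneg ha.le, Real.mul_rpow (by positivity) hx0'.le,
      Real.inv_rpow ha.le, Real.rpow_neg ha.le, inv_inv]
  have hU := singularPart_le d hk (b := 1 / 2) (by norm_num)
    (smul_ne_zero (inv_ne_zero hε.ne') hx0)
  have hU0 := singularPart_nonneg d hk (smul_ne_zero (inv_ne_zero hε.ne') hx0)
  rw [show k + 2 * (1 / 2) = k + 1 by ring, hscale hε] at hU
  have hUε : 0 ≤ ε ^ (-k) * singularPart d k (ε⁻¹ • x) := by positivity
  rw [norm_mul, norm_sub_rev, powerPotential_sub_regularization hε,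
    Real.norm_of_nonneg (show 0 ≤ rescale ζ δ x from hζ.nonneg _), Real.norm_of_nonneg hUε, hmin,
    Real.norm_of_nonneg (Real.rpow_nonneg (norm_nonneg _) _), hscale hδ]
  have h1 : δ ^ (-(k + 1)) * δ ^ (k + 1) = 1 := by rw [← Real.rpow_add hδ]; simp
  have h2 : ε ^ (-k) * ε ^ (k + 1) = ε := by
    rw [← Real.rpow_add hε]
    ring_nf
    exact Real.rpow_one _
  calc rescale ζ δ x * (ε ^ (-k) * singularPart d k (ε⁻¹ • x))
      ≤ 1 * (ε ^ (-k) * (Real.Gamma (k / 2 + 1 / 2) / Real.Gamma (k / 2) *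
        (ε ^ (k + 1) * ‖x‖ ^ (-(k + 1))))) := by
        gcongr
        exact hζ.le_one _
    _ = Real.Gamma (k / 2 + 1 / 2) / Real.Gamma (k / 2) * (ε ^ (-k) * ε ^ (k + 1)) *
        (δ ^ (-(k + 1)) * δ ^ (k + 1)) * ‖x‖ ^ (-(k + 1)) := by rw [h1]; ring
    _ = _ := by rw [h2]; ring

lemma sumNorm_rescale_mul_le {d : ℕ} (hd : 0 < d) {k q ε δ : ℝ} (p : ℝ)
    {ζ : EuclideanSpace ℝ (Fin d) → ℝ} (hζ : IsCutoff d ζ) (hk : 0 < k) (hq : 0 < q)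
    (hkq : d < k * q) (hε : 0 < ε) (hδ : 0 < δ) :
    sumNorm p q (fun x => rescale ζ δ x * (regularization d k ε x - powerPotential d k x)) ≤
      ENNReal.ofReal (Real.Gamma (k / 2 + 1 / 2) / Real.Gamma (k / 2) *
        (eLpNorm (fun x : EuclideanSpace ℝ (Fin d) =>
          min (‖x‖ ^ (-(0 : ℝ))) (‖x‖ ^ (-(k + 1)))) (ENNReal.ofReal q) volume).toReal *
        (ε / δ ^ (k + 1 - d / q))) := by
  have hG := Real.Gamma_pos_of_pos (half_pos hk)
  have hG' := Real.Gamma_pos_of_pos (show 0 < k / 2 + 1 / 2 by linarith)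
  have hd' : (0 : ℝ) < d := by exact_mod_cast hd
  have hmem := memLp_min_norm_rpow hd (a := 0) (b := k + 1) hq (by linarith) (by nlinarith)
  set g := fun x : EuclideanSpace ℝ (Fin d) => min (‖x‖ ^ (-(0 : ℝ))) (‖x‖ ^ (-(k + 1))) with hg
  have hle := eLpNorm_le_mul_eLpNorm_of_ae_le_mul (p := ENNReal.ofReal q) (μ := volume)
    (g := fun x => g (δ⁻¹ • x))
    (.of_forall (norm_rescale_mul_le hζ hk hε hδ) :
      ∀ᵐ x, ‖rescale ζ δ x * (regularization d k ε x - powerPotential d k x)‖ ≤ _)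
  rw [eLpNorm_comp_inv_smul _ hq hδ, ← mul_assoc, ← ENNReal.ofReal_mul (by positivity),
    ← ENNReal.ofReal_toReal hmem.eLpNorm_ne_top, ← ENNReal.ofReal_mul (by positivity)] at hle
  refine (sumNorm_le_right ⟨?_, hle.trans_lt ENNReal.ofReal_lt_top⟩).trans (hle.trans_eq ?_)
  · refine Measurable.aestronglyMeasurable (Measurable.mul ?_
      ((continuous_regularization d hk ε).measurable.sub (measurable_powerPotential d k)))
    exact (hζ.contDiff.continuous.comp (continuous_const_smul _)).measurable
  · congr 1
    have h1 : δ ^ (-(k + 1)) * δ ^ (d / q) = (δ ^ (k + 1 - d / q))⁻¹ := by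
      rw [← Real.rpow_add hδ, ← Real.rpow_neg hδ.le]
      ring_nf
    rw [div_eq_mul_inv ε, ← h1]
    ring

lemma tendsto_rpow_nhdsGT_zero {s : ℝ} (hs : 0 < s) :
    Tendsto (fun ε : ℝ => ε ^ s) (𝓝[>] 0) (𝓝 0) := by
  have := (Real.continuous_rpow_const hs.le).tendsto 0
  rw [Real.zero_rpow hs.ne'] at this
  exact this.mono_left nhdsWithin_le_nhds

lemma exists_isRegularization_regularization {d : ℕ} (hd : 0 < d) {k p q : ℝ} (hk : 0 < k)
    (hp : 1 ≤ p) (hpd : p < d / k) (hq : d / k < q) :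
    ∃ C₀ > 0, ∀ r : ℕ, IsRegularization d k p q C₀ r (regularization d k) := by
  have hG := Real.Gamma_pos_of_pos (half_pos hk)
  have hG' := Real.Gamma_pos_of_pos (show 0 < k / 2 + 1 / 2 by linarith)
  have hp0 : 0 < p := by linarith
  have hkp : k * p < d := by rw [lt_div_iff₀ hk] at hpd; linarith
  have hkq : d < k * q := by rw [div_lt_iff₀ hk] at hq; linarith
  have hq0 : 0 < q := by linarith
  have hdp : 0 < d / p - k := by
    rw [sub_pos, lt_div_iff₀ hp0]
    exact hkp
  -- The `L^q` estimate alone suffices for the truncated bound; the summand `1` only secures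
  -- positivity of the constant.
  refine ⟨Real.Gamma (k / 2 + 1 / 2) / Real.Gamma (k / 2) *
        (eLpNorm (fun x : EuclideanSpace ℝ (Fin d) =>
          min (‖x‖ ^ (-(0 : ℝ))) (‖x‖ ^ (-(k + 1)))) (ENNReal.ofReal q) volume).toReal + 1,
    by positivity, fun r => ?_⟩
  refine ⟨fun ε _ _ => contDiff_regularization d hk ε r,
    fun ε hε _ => fourierNonneg_regularization hk hε,
    ⟨fun ε => ε ^ (d / p - k) *
        (eLpNorm (singularPart d k) (ENNReal.ofReal p) volume).toReal, ?_,
      fun ε hε _ => sumNorm_regularization_sub_le hd q hk hp hkp hε⟩,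
    fun ζ hζ ε hε _ δ hδ _ => (sumNorm_rescale_mul_le hd p hζ hk hq0 hkq hε hδ).trans ?_,
    fun ε hε _ x hx => (regularization_le_powerPotential hk hε hx).trans (by linarith),
    ⟨fun ε => ε ^ k * (regularPart d k 0)⁻¹, ?_, fun ε hε _ => ?_⟩⟩
  · simpa using (tendsto_rpow_nhdsGT_zero hdp).mul_const
      (eLpNorm (singularPart d k) (ENNReal.ofReal p) volume).toReal
  · refine ENNReal.ofReal_le_ofReal ?_
    gcongr
    · linarith
    · have : 0 ≤ δ ^ (d / p - k) := by positivity
      linarith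
  · simpa using (tendsto_rpow_nhdsGT_zero hk).mul_const (regularPart d k 0)⁻¹
  · have h0 := regularPart_pos d hk 0
    refine ⟨by positivity, ?_⟩
    rw [eLpNorm_top_regularization hk hε, regularization_zero, Real.rpow_neg hε.le, one_div,
      mul_inv, inv_inv]

/-! ### Positive definite kernels. -/

lemma ENNReal.two_mul_mul_le_sq_add_sq (a b : ℝ≥0∞) : 2 * (a * b) ≤ a * a + b * b := by
  wlog h : a ≤ b generalizing a b
  · rw [mul_comm a b, add_comm]
    exact this b a (le_of_not_ge h)
  obtain ⟨c, rfl⟩ := exists_add_of_le h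
  calc 2 * (a * (a + c)) ≤ 2 * (a * (a + c)) + c * c := le_self_add
    _ = _ := by ring

/-- The translation-invariant kernel `K(x - y)` is positive definite, in a form that also makes
sense for unbounded non-negative kernels. -/
def IsPosDefKernel {E : Type*} [AddGroup E] [MeasurableSpace E] (K : E → ℝ≥0∞) : Prop :=
  ∀ α β : Measure E, IsFiniteMeasure α → IsFiniteMeasure β →
    2 * ∫⁻ x, ∫⁻ y, K (x - y) ∂β ∂α ≤
      ∫⁻ x, ∫⁻ y, K (x - y) ∂α ∂α + ∫⁻ x, ∫⁻ y, K (x - y) ∂β ∂β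

lemma lintegral_lintegral_lintegral_mul {E Ω : Type*} [MeasurableSpace E] [MeasurableSpace Ω]
    {h : E → Ω → ℝ≥0∞} (hh : Measurable (Function.uncurry h)) (α β : Measure E) [SFinite α]
    [SFinite β] (m : Measure Ω) [SFinite m] :
    ∫⁻ x, ∫⁻ y, ∫⁻ z, h x z * h y z ∂m ∂β ∂α =
      ∫⁻ z, (∫⁻ x, h x z ∂α) * (∫⁻ y, h y z ∂β) ∂m := by
  have hz : ∀ z, Measurable fun y => h y z := fun z => hh.comp measurable_prodMk_right
  have hx : ∀ x, Measurable fun z => h x z := fun x => hh.comp measurable_prodMk_left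
  have h1 : ∀ x, ∫⁻ y, ∫⁻ z, h x z * h y z ∂m ∂β = ∫⁻ z, h x z * ∫⁻ y, h y z ∂β ∂m := by
    intro x
    rw [lintegral_lintegral_swap]
    · exact lintegral_congr fun z => lintegral_const_mul _ (hz z)
    · exact (((hx x).comp measurable_snd).mul hh).aemeasurable
  simp_rw [h1]
  rw [lintegral_lintegral_swap]
  · exact lintegral_congr fun z => lintegral_mul_const _ (hz z)
  · exact (hh.mul ((hh.comp measurable_swap).lintegral_prod_right'.comp
      measurable_snd)).aemeasurable

/-- Up to the constant `c`, a Gaussian is the convolution square of a narrower one: `2b(|x-z|² +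
|y-z|²) = b|x-y|² + 4b|z-(x+y)/2|²`. The double integrals thus become `∫ H_α H_β dz`, where `H_α`
and `H_β` integrate `h · z` against `α` and `β`, and the claim is `2ab ≤ a² + b²` pointwise in `z`.
-/
lemma isPosDefKernel_gaussian {E : Type*} [NormedAddCommGroup E] [InnerProductSpace ℝ E]
    [FiniteDimensional ℝ E] [MeasurableSpace E] [BorelSpace E] {b : ℝ} (hb : 0 < b) :
    IsPosDefKernel fun x : E => ENNReal.ofReal (Real.exp (-(b * ‖x‖ ^ 2))) := by
  intro α β _ _
  set h : E → E → ℝ≥0∞ := fun x z => ENNReal.ofReal (Real.exp (-(2 * b * ‖x - z‖ ^ 2))) with hh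
  set c : ℝ≥0∞ := ∫⁻ z : E, ENNReal.ofReal (Real.exp (-(4 * b * ‖z‖ ^ 2))) with hc
  have hmeas : Measurable (Function.uncurry h) := by
    simp only [hh, Function.uncurry_def]
    fun_prop
  have hint : Integrable fun z : E => Real.exp (-(4 * b * ‖z‖ ^ 2)) := by
    have hbc : 0 < ((4 * b : ℝ) : ℂ).re := by simpa using hb
    have := (GaussianFourier.integrable_cexp_neg_mul_sq_norm_add hbc 0 (0 : E)).norm
    simpa [Complex.norm_exp, ← Complex.ofReal_pow] using this
  have hcr : c = ENNReal.ofReal (∫ z : E, Real.exp (-(4 * b * ‖z‖ ^ 2))) :=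
    (ofReal_integral_eq_lintegral_ofReal hint (.of_forall fun z => (Real.exp_pos _).le)).symm
  have hc_top : c ≠ ⊤ := hcr ▸ ENNReal.ofReal_ne_top
  have hc_zero : c ≠ 0 := by
    rw [hcr, ne_eq, ENNReal.ofReal_eq_zero, not_le]
    exact integral_exp_pos hint
  have key : ∀ x y : E, ∫⁻ z, h x z * h y z =
      c * ENNReal.ofReal (Real.exp (-(b * ‖x - y‖ ^ 2))) := by
    intro x y
    have h1 : ∀ z : E, h x z * h y z = ENNReal.ofReal (Real.exp (-(b * ‖x - y‖ ^ 2))) *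
        ENNReal.ofReal (Real.exp (-(4 * b * ‖z - (1 / 2 : ℝ) • (x + y)‖ ^ 2))) := by
      intro z
      rw [hh]
      simp only
      rw [← ENNReal.ofReal_mul (Real.exp_pos _).le, ← ENNReal.ofReal_mul (Real.exp_pos _).le,
        ← Real.exp_add, ← Real.exp_add]
      congr 2
      have e1 : ‖z - (1 / 2 : ℝ) • (x + y)‖ ^ 2 =
          ‖z‖ ^ 2 - inner ℝ z x - inner ℝ z y +
            (1 / 4) * (‖x‖ ^ 2 + 2 * inner ℝ x y + ‖y‖ ^ 2) := by
        rw [norm_sub_sq_real, norm_smul, mul_pow, norm_add_sq_real, inner_smul_right,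
          inner_add_right]
        norm_num
        ring
      rw [e1, norm_sub_sq_real, norm_sub_sq_real, norm_sub_sq_real, real_inner_comm z x,
        real_inner_comm z y]
      ring
    simp_rw [h1]
    rw [lintegral_const_mul _ (by fun_prop), mul_comm, hc, lintegral_sub_right_eq_self
      (fun z : E => ENNReal.ofReal (Real.exp (-(4 * b * ‖z‖ ^ 2))))]
  have hK : ∀ α β : Measure E, IsFiniteMeasure α → IsFiniteMeasure β →
      c * ∫⁻ x, ∫⁻ y, ENNReal.ofReal (Real.exp (-(b * ‖x - y‖ ^ 2))) ∂β ∂α =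
        ∫⁻ z, (∫⁻ x, h x z ∂α) * (∫⁻ y, h y z ∂β) := by
    intro α β _ _
    rw [← lintegral_lintegral_lintegral_mul hmeas, ← lintegral_const_mul' _ _ hc_top]
    refine lintegral_congr fun x => ?_
    rw [← lintegral_const_mul' _ _ hc_top]
    exact lintegral_congr fun y => (key x y).symm
  have hH : ∀ α : Measure E, IsFiniteMeasure α → Measurable fun z => ∫⁻ x, h x z ∂α :=
    fun α _ => (hmeas.comp measurable_swap).lintegral_prod_right'
  have hHH : ∀ α β : Measure E, IsFiniteMeasure α → IsFiniteMeasure β →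
      Measurable fun z => (∫⁻ x, h x z ∂α) * ∫⁻ y, h y z ∂β :=
    fun α β hα hβ => (hH α hα).mul (hH β hβ)
  rw [← ENNReal.mul_le_mul_iff_right hc_zero hc_top, mul_add, mul_left_comm,
    hK α β ‹_› ‹_›, hK α α ‹_› ‹_›, hK β β ‹_› ‹_›,
    ← lintegral_add_left (hHH α α ‹_› ‹_›),
    ← lintegral_const_mul _ (hHH α β ‹_› ‹_›)]
  exact lintegral_mono fun z => ENNReal.two_mul_mul_le_sq_add_sq _ _

lemma IsPosDefKernel.const_mul {E : Type*} [AddGroup E] [MeasurableSpace E] {K : E → ℝ≥0∞}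
    (hK : IsPosDefKernel K) {c : ℝ≥0∞} (hc : c ≠ ⊤) : IsPosDefKernel fun x => c * K x := by
  intro α β hα hβ
  simp only [lintegral_const_mul' c _ hc]
  rw [mul_left_comm, ← mul_add]
  gcongr
  exact hK α β hα hβ

lemma IsPosDefKernel.lintegral {E Ω : Type*} [AddGroup E] [MeasurableSpace E] [MeasurableSub₂ E]
    [MeasurableSpace Ω] {K : Ω → E → ℝ≥0∞} (hK : Measurable (Function.uncurry K))
    {ρ : Measure Ω} [SFinite ρ] (h : ∀ᵐ t ∂ρ, IsPosDefKernel (K t)) :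
    IsPosDefKernel fun x => ∫⁻ t, K t x ∂ρ := by
  have hswap : ∀ α β : Measure E, IsFiniteMeasure α → IsFiniteMeasure β →
      ∫⁻ x, ∫⁻ y, ∫⁻ t, K t (x - y) ∂ρ ∂β ∂α = ∫⁻ t, ∫⁻ x, ∫⁻ y, K t (x - y) ∂β ∂α ∂ρ := by
    intro α β _ _
    have h1 : ∀ x, ∫⁻ y, ∫⁻ t, K t (x - y) ∂ρ ∂β = ∫⁻ t, ∫⁻ y, K t (x - y) ∂β ∂ρ := by
      intro x
      refine lintegral_lintegral_swap (Measurable.aemeasurable ?_)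
      exact hK.comp (measurable_snd.prodMk (measurable_const.sub measurable_fst))
    simp_rw [h1]
    refine lintegral_lintegral_swap (Measurable.aemeasurable ?_)
    exact Measurable.lintegral_prod_right' (f := fun z : (E × Ω) × E => K z.1.2 (z.1.1 - z.2))
      (hK.comp ((measurable_snd.comp measurable_fst).prodMk
        ((measurable_fst.comp measurable_fst).sub measurable_snd)))
  have hmeas : ∀ α β : Measure E, IsFiniteMeasure α → IsFiniteMeasure β →
      Measurable fun t => ∫⁻ x, ∫⁻ y, K t (x - y) ∂β ∂α := by
    intro α β _ _
    refine Measurable.lintegral_prod_right' (f := fun z : Ω × E => ∫⁻ y, K z.1 (z.2 - y) ∂β) ?_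
    exact Measurable.lintegral_prod_right' (f := fun z : (Ω × E) × E => K z.1.1 (z.1.2 - z.2))
      (hK.comp ((measurable_fst.comp measurable_fst).prodMk
        ((measurable_snd.comp measurable_fst).sub measurable_snd)))
  intro α β hα hβ
  rw [hswap α β hα hβ, hswap α α hα hα, hswap β β hβ hβ,
    ← lintegral_add_left (hmeas α α hα hα), ← lintegral_const_mul _ (hmeas α β hα hβ)]
  exact lintegral_mono_ae (h.mono fun t ht => ht α β hα hβ)

lemma isPosDefKernel_regularization {d : ℕ} {k ε : ℝ} (hk : 0 < k) (hε : 0 < ε) :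
    IsPosDefKernel fun x : EuclideanSpace ℝ (Fin d) =>
      ENNReal.ofReal (regularization d k ε x) := by
  have hG := Real.Gamma_pos_of_pos (half_pos hk)
  have h1 : (fun x : EuclideanSpace ℝ (Fin d) => ENNReal.ofReal (regularization d k ε x)) =
      fun x => ENNReal.ofReal (ε ^ (-k) * (Real.Gamma (k / 2))⁻¹) *
        ∫⁻ t in Set.Ioc (0 : ℝ) 1, ENNReal.ofReal (t ^ (k / 2 - 1)) *
          ENNReal.ofReal (Real.exp (-((t * ε⁻¹ ^ 2) * ‖x‖ ^ 2))) := by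
    funext x
    rw [regularization_eq_integral, ENNReal.ofReal_mul (by positivity)]
    congr 1
    rw [ofReal_integral_eq_lintegral_ofReal]
    · refine setLIntegral_congr_fun measurableSet_Ioc fun t ht => ?_
      rw [ENNReal.ofReal_mul (Real.exp_pos _).le, mul_comm]
    · have := integrableOn_lowerGamma (half_pos hk) (ε⁻¹ ^ 2 * ‖x‖ ^ 2)
      simpa only [mul_assoc, IntegrableOn] using this
    · refine (ae_restrict_iff' measurableSet_Ioc).2 (.of_forall fun t ht => ?_)
      have h0 : 0 ≤ t ^ (k / 2 - 1) := Real.rpow_nonneg ht.1.le _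
      simp only [Pi.zero_apply]
      positivity
  rw [h1]
  refine IsPosDefKernel.const_mul (IsPosDefKernel.lintegral ?_ ?_) ENNReal.ofReal_ne_top
  · simp only [Function.uncurry_def]
    fun_prop
  · refine (ae_restrict_iff' measurableSet_Ioc).2 (.of_forall fun t ht => ?_)
    have ht0 := ht.1
    exact (isPosDefKernel_gaussian (by positivity)).const_mul ENNReal.ofReal_ne_top

/-! ### Quadratic energies of differences of measures. -/

/-- The quadratic energy `∫∫ f(x - y) (ν - μ)^{⊗2}(dx dy)`, with the diagonal included. -/
def pairEnergy {d : ℕ} (f : EuclideanSpace ℝ (Fin d) → ℝ)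
    (μ ν : Measure (EuclideanSpace ℝ (Fin d))) : ℝ :=
  ∫ z, f (z.1 - z.2) ∂(ν.prod ν) - ∫ z, f (z.1 - z.2) ∂(ν.prod μ) -
    ∫ z, f (z.1 - z.2) ∂(μ.prod ν) + ∫ z, f (z.1 - z.2) ∂(μ.prod μ)

lemma integral_prod_sub_comm {d : ℕ} {f : EuclideanSpace ℝ (Fin d) → ℝ}
    (hf : ∀ x, f (-x) = f x) (α β : Measure (EuclideanSpace ℝ (Fin d))) [SFinite α] [SFinite β] :
    ∫ z, f (z.1 - z.2) ∂(α.prod β) = ∫ z, f (z.1 - z.2) ∂(β.prod α) := by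
  rw [← integral_prod_swap]
  refine integral_congr_ae (.of_forall fun z => ?_)
  simp only [Prod.fst_swap, Prod.snd_swap]
  rw [← hf, neg_sub]

/-- Boundedness makes all four integrals finite, so the inequality between extended non-negative
integrals can be rearranged into one with subtraction. -/
lemma pairEnergy_nonneg {d : ℕ} {f : EuclideanSpace ℝ (Fin d) → ℝ} (hf : Continuous f)
    (hf0 : ∀ x, 0 ≤ f x) {B : ℝ} (hfB : ∀ x, f x ≤ B) (heven : ∀ x, f (-x) = f x)
    (hpd : IsPosDefKernel fun x => ENNReal.ofReal (f x))
    (μ ν : Measure (EuclideanSpace ℝ (Fin d))) [IsFiniteMeasure μ] [IsFiniteMeasure ν] :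
    0 ≤ pairEnergy f μ ν := by
  have hI : ∀ α β : Measure (EuclideanSpace ℝ (Fin d)), IsFiniteMeasure α → IsFiniteMeasure β →
      Integrable (fun z => f (z.1 - z.2)) (α.prod β) := by
    intro α β _ _
    refine Integrable.of_bound (by fun_prop) B (.of_forall fun z => ?_)
    rw [Real.norm_of_nonneg (hf0 _)]
    exact hfB _
  have hL : ∀ α β : Measure (EuclideanSpace ℝ (Fin d)), IsFiniteMeasure α → IsFiniteMeasure β →
      ∫⁻ x, ∫⁻ y, ENNReal.ofReal (f (x - y)) ∂β ∂α =
        ENNReal.ofReal (∫ z, f (z.1 - z.2) ∂(α.prod β)) := by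
    intro α β hα hβ
    rw [ofReal_integral_eq_lintegral_ofReal (hI α β hα hβ) (.of_forall fun z => hf0 _),
      lintegral_prod _ (by fun_prop)]
  have hN : ∀ α β : Measure (EuclideanSpace ℝ (Fin d)),
      0 ≤ ∫ z, f (z.1 - z.2) ∂(α.prod β) := fun α β => integral_nonneg fun z => hf0 _
  have h := hpd ν μ ‹_› ‹_›
  rw [hL ν μ ‹_› ‹_›, hL ν ν ‹_› ‹_›, hL μ μ ‹_› ‹_›, ← ENNReal.ofReal_add (hN _ _) (hN _ _),
    two_mul, ← ENNReal.ofReal_add (hN _ _) (hN _ _),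
    ENNReal.ofReal_le_ofReal_iff (add_nonneg (hN _ _) (hN _ _))] at h
  rw [pairEnergy, integral_prod_sub_comm heven μ ν]
  linarith

/-! ### Interactions with a measure of bounded density. -/

section BoundedDensity

variable {d : ℕ} {A : ℝ} {f : EuclideanSpace ℝ (Fin d) → ℝ}
  {μ : Measure (EuclideanSpace ℝ (Fin d))} {α : Measure (EuclideanSpace ℝ (Fin d))}

/-- For fixed `x`, domination by `A` times Lebesgue measure and translation invariance bound the
inner integral by `A ‖f‖_1`, whatever `α` is. -/
lemma lintegral_prod_sub_le [SFinite μ] (hf : Measurable f)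
    (hμ : μ ≤ ENNReal.ofReal A • volume) :
    ∫⁻ z, ‖f (z.1 - z.2)‖ₑ ∂(α.prod μ) ≤
      ENNReal.ofReal A * (∫⁻ x, ‖f x‖ₑ) * α Set.univ := by
  rw [lintegral_prod _ (by fun_prop)]
  calc ∫⁻ x, ∫⁻ y, ‖f (x - y)‖ₑ ∂μ ∂α
      ≤ ∫⁻ _, ENNReal.ofReal A * (∫⁻ x, ‖f x‖ₑ) ∂α := by
        refine lintegral_mono fun x => ?_
        refine (lintegral_mono' hμ le_rfl).trans_eq ?_
        rw [lintegral_smul_measure, smul_eq_mul,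
          lintegral_sub_left_eq_self (fun y => ‖f y‖ₑ) x]
    _ = _ := by rw [lintegral_const]

lemma integrable_prod_sub [SFinite μ] [IsFiniteMeasure α] (hf : Measurable f)
    (hfi : Integrable f) (hμ : μ ≤ ENNReal.ofReal A • volume) :
    Integrable (fun z => f (z.1 - z.2)) (α.prod μ) :=
  ⟨(hf.comp (measurable_fst.sub measurable_snd)).aestronglyMeasurable,
    (lintegral_prod_sub_le hf hμ).trans_lt (ENNReal.mul_lt_top
    (ENNReal.mul_lt_top ENNReal.ofReal_lt_top hfi.2) (measure_lt_top _ _))⟩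

lemma integral_prod_sub_le [SFinite μ] [IsProbabilityMeasure α] (hA : 0 ≤ A)
    (hf : Measurable f) (hfi : Integrable f) (hμ : μ ≤ ENNReal.ofReal A • volume) :
    ∫ z, f (z.1 - z.2) ∂(α.prod μ) ≤ A * ∫ x, ‖f x‖ := by
  refine (Real.le_norm_self _).trans ((norm_integral_le_integral_norm _).trans ?_)
  rw [integral_norm_eq_lintegral_enorm (integrable_prod_sub hf hfi hμ).1,
    integral_norm_eq_lintegral_enorm hf.aestronglyMeasurable]
  have h := lintegral_prod_sub_le (α := α) hf hμ
  rw [measure_univ, mul_one] at h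
  have h2 := ENNReal.toReal_mono (ENNReal.mul_ne_top ENNReal.ofReal_ne_top hfi.2.ne) h
  rwa [ENNReal.toReal_mul, ENNReal.toReal_ofReal hA] at h2

/-- The origin is excluded because the remainder is negative there; the diagonal is null since `μ`
is absolutely continuous. -/
lemma integral_prod_sub_nonneg [SFinite μ] [IsFiniteMeasure α] (hd : 0 < d)
    (hf : Measurable f) (hfi : Integrable f) (hf0 : ∀ x ≠ 0, 0 ≤ f x)
    (hμ : μ ≤ ENNReal.ofReal A • volume) :
    0 ≤ ∫ z, f (z.1 - z.2) ∂(α.prod μ) := by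
  have : NeZero d := ⟨hd.ne'⟩
  rw [integral_prod _ (integrable_prod_sub hf hfi hμ)]
  refine integral_nonneg fun x => integral_nonneg_of_ae ?_
  have hac : μ ≪ volume :=
    (Measure.absolutelyContinuous_of_le hμ).trans Measure.smul_absolutelyContinuous
  filter_upwards [hac.ae_le (Measure.ae_ne volume x)] with y hy
  exact hf0 _ (sub_ne_zero.2 hy.symm)

end BoundedDensity

/-! ### Weighted empirical measures. -/

section Empirical

variable {d N : ℕ} {x : Fin N → EuclideanSpace ℝ (Fin d)} {m : Fin N → ℝ}

instance : IsFiniteMeasure (empiricalMeasure x m) := by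
  refine ⟨?_⟩
  simp [empiricalMeasure, ENNReal.sum_lt_top]

lemma isProbabilityMeasure_empiricalMeasure (hN : 0 < N) (hm : IsWeight m) :
    IsProbabilityMeasure (empiricalMeasure x m) := by
  have hN' : (0 : ℝ) < N := by exact_mod_cast hN
  refine ⟨?_⟩
  simp only [empiricalMeasure, Measure.coe_finsetSum, Finset.sum_apply, Measure.smul_apply,
    measure_univ, smul_eq_mul, mul_one]
  rw [← ENNReal.ofReal_sum_of_nonneg fun i _ => div_nonneg (hm.nonneg i) hN'.le,
    ← Finset.sum_div, hm.sum_eq, div_self hN'.ne', ENNReal.ofReal_one]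

lemma integrable_empiricalMeasure (f : EuclideanSpace ℝ (Fin d) → ℝ) :
    Integrable f (empiricalMeasure x m) :=
  integrable_finsetSum_measure.2 fun _ _ =>
    (integrable_dirac (by simp)).smul_measure ENNReal.ofReal_ne_top

lemma integral_empiricalMeasure (hm : IsWeight m) (f : EuclideanSpace ℝ (Fin d) → ℝ) :
    ∫ y, f y ∂(empiricalMeasure x m) = ∑ i, m i / N * f (x i) := by
  rw [empiricalMeasure, integral_finsetSum_measure fun _ _ =>
    (integrable_dirac (by simp)).smul_measure ENNReal.ofReal_ne_top]
  refine Finset.sum_congr rfl fun i _ => ?_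
  rw [integral_smul_measure, integral_dirac,
    ENNReal.toReal_ofReal (div_nonneg (hm.nonneg i) (Nat.cast_nonneg _)), smul_eq_mul]

lemma integrable_empiricalMeasure_prod {f : EuclideanSpace ℝ (Fin d) → ℝ} (hf : Measurable f) :
    Integrable (fun z => f (z.1 - z.2)) ((empiricalMeasure x m).prod (empiricalMeasure x m)) :=
  (integrable_prod_iff
    (hf.comp (measurable_fst.sub measurable_snd)).aestronglyMeasurable).2
    ⟨.of_forall fun _ => integrable_empiricalMeasure _, integrable_empiricalMeasure _⟩

lemma integral_empiricalMeasure_prod (hm : IsWeight m) {f : EuclideanSpace ℝ (Fin d) → ℝ}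
    (hf : Measurable f) :
    ∫ z, f (z.1 - z.2) ∂((empiricalMeasure x m).prod (empiricalMeasure x m)) =
      1 / (N : ℝ) ^ 2 * (∑ ij ∈ (Finset.univ : Finset (Fin N)).offDiag,
        m ij.1 * m ij.2 * f (x ij.1 - x ij.2) + (∑ i, m i ^ 2) * f 0) := by
  rw [integral_prod _ (integrable_empiricalMeasure_prod hf)]
  simp only [integral_empiricalMeasure hm]
  have h1 : ∑ i, m i / N * ∑ j, m j / N * f (x i - x j) =
      1 / (N : ℝ) ^ 2 * ∑ ij ∈ Finset.univ ×ˢ Finset.univ,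
        m ij.1 * m ij.2 * f (x ij.1 - x ij.2) := by
    rw [Finset.sum_product, Finset.mul_sum]
    refine Finset.sum_congr rfl fun i _ => ?_
    rw [Finset.mul_sum, Finset.mul_sum]
    exact Finset.sum_congr rfl fun j _ => by ring
  rw [h1, ← Finset.diag_union_offDiag, Finset.sum_union (Finset.disjoint_diag_offDiag _),
    Finset.sum_diag, Finset.sum_mul, add_comm]
  simp only [sub_self, sq]

lemma sum_sq_le {M : ℝ} (hm : IsWeight m) (hM : ∀ i, m i ≤ M) : ∑ i, m i ^ 2 ≤ M * N := by
  rw [← hm.sum_eq, Finset.mul_sum]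
  refine Finset.sum_le_sum fun i _ => ?_
  rw [sq]
  exact mul_le_mul_of_nonneg_right (hM i) (hm.nonneg i)

end Empirical

/-! ### The renormalized energy and its splitting. -/

lemma isProbabilityMeasure_densityMeasure {d : ℕ} {μ : EuclideanSpace ℝ (Fin d) → ℝ}
    (hμ : IsBoundedDensity μ) : IsProbabilityMeasure (densityMeasure μ) := by
  refine ⟨?_⟩
  rw [densityMeasure, withDensity_apply _ MeasurableSet.univ, Measure.restrict_univ,
    ← ofReal_integral_eq_lintegral_ofReal hμ.integrable hμ.nonneg, hμ.integral_eq_one,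
    ENNReal.ofReal_one]

lemma densityMeasure_le {d : ℕ} {μ : EuclideanSpace ℝ (Fin d) → ℝ} {A : ℝ}
    (hμ : IsBoundedDensity μ) (hA : supNorm μ ≤ A) :
    densityMeasure μ ≤ ENNReal.ofReal A • volume := by
  rw [densityMeasure, ← withDensity_const]
  refine withDensity_mono ?_
  filter_upwards [ae_le_eLpNormEssSup (f := μ) (μ := volume), hμ.nonneg] with x hx hx0
  rw [Real.enorm_of_nonneg hx0, ← eLpNorm_exponent_top] at hx
  exact hx.trans (ENNReal.le_ofReal_iff_toReal_le hμ.memLp_top.eLpNorm_ne_top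
    (ENNReal.toReal_nonneg.trans hA) |>.2 hA)

/-- The default value of the potential at the origin is `0`, so the diagonal contributes nothing and
the restriction to `x ≠ y` can be dropped. -/
lemma interaction_eq_integral (d : ℕ) {k : ℝ} (hk : 0 < k)
    (α β : Measure (EuclideanSpace ℝ (Fin d))) :
    interaction d k α β = ∫ z, powerPotential d k (z.1 - z.2) ∂(α.prod β) := by
  refine setIntegral_eq_integral_of_forall_compl_eq_zero fun z hz => ?_
  have hz' : z.1 = z.2 := by simpa [offDiagonal] using hz
  rw [hz', sub_self, powerPotential_zero d hk]

lemma renormalizedEnergy_eq_pairEnergy (d : ℕ) {k : ℝ} (hk : 0 < k)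
    (μ ν : Measure (EuclideanSpace ℝ (Fin d))) :
    renormalizedEnergy d k μ ν = pairEnergy (powerPotential d k) μ ν := by
  simp only [renormalizedEnergy, pairEnergy, interaction_eq_integral d hk]

lemma powerPotential_neg (d : ℕ) (k : ℝ) (x : EuclideanSpace ℝ (Fin d)) :
    powerPotential d k (-x) = powerPotential d k x := by
  simp [powerPotential]

lemma integrable_regularization_prod {d : ℕ} {k ε : ℝ} (hk : 0 < k) (hε : 0 < ε)
    (α β : Measure (EuclideanSpace ℝ (Fin d))) [IsFiniteMeasure α] [IsFiniteMeasure β] :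
    Integrable (fun z => regularization d k ε (z.1 - z.2)) (α.prod β) := by
  have := continuous_regularization d hk ε
  refine Integrable.of_bound (by fun_prop) (regularization d k ε 0) (.of_forall fun z => ?_)
  rw [Real.norm_of_nonneg (regularization_pos hk hε _).le]
  exact regularization_le_zero hk hε _

lemma measurable_remainder {d : ℕ} {k : ℝ} (hk : 0 < k) (ε : ℝ) :
    Measurable fun x : EuclideanSpace ℝ (Fin d) =>
      powerPotential d k x - regularization d k ε x :=
  (measurable_powerPotential d k).sub (continuous_regularization d hk ε).measurable

lemma integrable_remainder {d : ℕ} {k ε : ℝ} (hk : 0 < k) (hkd : k < d) (hε : 0 < ε) :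
    Integrable fun x : EuclideanSpace ℝ (Fin d) =>
      powerPotential d k x - regularization d k ε x := by
  simp_rw [powerPotential_sub_regularization hε]
  exact ((integrable_singularPart hk hkd).comp_smul (inv_ne_zero hε.ne')).const_mul _

lemma integral_norm_remainder {d : ℕ} {k ε : ℝ} (hε : 0 < ε) :
    ∫ x : EuclideanSpace ℝ (Fin d), ‖powerPotential d k x - regularization d k ε x‖ =
      ε ^ (d - k) * ∫ x, ‖singularPart d k x‖ := by
  simp_rw [powerPotential_sub_regularization hε, norm_mul]
  rw [integral_const_mul, Measure.integral_comp_inv_smul volume (fun x => ‖singularPart d k x‖),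
    finrank_euclideanSpace_fin, abs_of_pos (by positivity), Real.norm_of_nonneg (by positivity),
    smul_eq_mul, ← mul_assoc, ← Real.rpow_natCast, ← Real.rpow_add hε]
  ring_nf

lemma integrable_powerPotential_prod_swap {d : ℕ} {k : ℝ}
    {α β : Measure (EuclideanSpace ℝ (Fin d))} [SFinite α] [SFinite β]
    (h : Integrable (fun z => powerPotential d k (z.1 - z.2)) (α.prod β)) :
    Integrable (fun z => powerPotential d k (z.1 - z.2)) (β.prod α) := by
  refine h.swap.congr (.of_forall fun z => ?_)
  simp only [Function.comp_apply, Prod.fst_swap, Prod.snd_swap]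
  rw [← powerPotential_neg, neg_sub]

/-- At scale `1` the potential is an integrable remainder plus a bounded function; the first is
handled by the density bound, the second by finiteness of the measures. -/
lemma integrable_powerPotential_prod {d : ℕ} {k A : ℝ} (hk : 0 < k) (hkd : k < d)
    {α μ : Measure (EuclideanSpace ℝ (Fin d))} [IsFiniteMeasure α] [IsFiniteMeasure μ]
    (hμ : μ ≤ ENNReal.ofReal A • volume) :
    Integrable (fun z => powerPotential d k (z.1 - z.2)) (α.prod μ) := by
  refine ((integrable_prod_sub (α := α) (measurable_remainder hk 1)
    (integrable_remainder hk hkd one_pos) hμ).add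
    (integrable_regularization_prod hk one_pos α μ)).congr (.of_forall fun z => ?_)
  simp

/-- Off-diagonal near-field interactions are controlled by the renormalized energy, up to the
self-interaction of the regularized particles and the mass of the remainder `V - V_ε`. -/
lemma sum_remainder_le {d : ℕ} {k A : ℝ} (hk : 0 < k) (hkd : k < d) (hA : 0 ≤ A)
    {μ : EuclideanSpace ℝ (Fin d) → ℝ} (hμ : IsBoundedDensity μ) (hμA : supNorm μ ≤ A)
    {N : ℕ} (hN : 0 < N) (x : Fin N → EuclideanSpace ℝ (Fin d)) {m : Fin N → ℝ} {M : ℝ}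
    (hm : IsWeight m) (hM : ∀ i, m i ≤ M) {ε : ℝ} (hε : 0 < ε) :
    1 / (N : ℝ) ^ 2 * ∑ ij ∈ (Finset.univ : Finset (Fin N)).offDiag, m ij.1 * m ij.2 *
        (powerPotential d k (x ij.1 - x ij.2) - regularization d k ε (x ij.1 - x ij.2)) ≤
      renormalizedEnergy d k (densityMeasure μ) (empiricalMeasure x m) +
        M * (ε ^ (-k) * regularPart d k 0) / N +
        2 * A * (∫ x, ‖singularPart d k x‖) * ε ^ (d - k) := by
  have hd : 0 < d := by
    have : (0 : ℝ) < d := by linarith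
    exact_mod_cast this
  have hN' : (0 : ℝ) < N := by exact_mod_cast hN
  have := isProbabilityMeasure_densityMeasure hμ
  have := isProbabilityMeasure_empiricalMeasure (x := x) hN hm
  have hle := densityMeasure_le hμ hμA
  set ρ := densityMeasure μ
  set ν := empiricalMeasure x m
  set f : EuclideanSpace ℝ (Fin d) → ℝ :=
    fun x => powerPotential d k x - regularization d k ε x with hf
  have hfm : Measurable f := measurable_remainder hk ε
  have hfi : Integrable f := integrable_remainder hk hkd hε
  have hf0 : ∀ x ≠ 0, 0 ≤ f x := fun x hx =>
    sub_nonneg.2 (regularization_le_powerPotential hk hε hx)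
  have hfe : ∀ x, f (-x) = f x := fun x => by
    simp only [hf, powerPotential_neg, regularization_neg]
  have hsub : ∀ α β : Measure (EuclideanSpace ℝ (Fin d)), IsFiniteMeasure α → IsFiniteMeasure β →
      Integrable (fun z => powerPotential d k (z.1 - z.2)) (α.prod β) →
      ∫ z, f (z.1 - z.2) ∂(α.prod β) = ∫ z, powerPotential d k (z.1 - z.2) ∂(α.prod β) -
        ∫ z, regularization d k ε (z.1 - z.2) ∂(α.prod β) :=
    fun α β _ _ h => integral_sub h (integrable_regularization_prod hk hε α β)
  have hνρ : Integrable (fun z => powerPotential d k (z.1 - z.2)) (ν.prod ρ) :=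
    integrable_powerPotential_prod hk hkd hle
  have hsplit : renormalizedEnergy d k ρ ν =
      pairEnergy (regularization d k ε) ρ ν + pairEnergy f ρ ν := by
    rw [renormalizedEnergy_eq_pairEnergy d hk]
    simp only [pairEnergy]
    rw [hsub ν ν inferInstance inferInstance
        (integrable_empiricalMeasure_prod (measurable_powerPotential d k)),
      hsub ν ρ inferInstance inferInstance hνρ,
      hsub ρ ν inferInstance inferInstance (integrable_powerPotential_prod_swap hνρ),
      hsub ρ ρ inferInstance inferInstance (integrable_powerPotential_prod hk hkd hle)]
    ring
  have hreg : 0 ≤ pairEnergy (regularization d k ε) ρ ν :=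
    pairEnergy_nonneg (continuous_regularization d hk ε) (fun x => (regularization_pos hk hε x).le)
      (regularization_le_zero hk hε) (regularization_neg d k ε)
      (isPosDefKernel_regularization hk hε) ρ ν
  have hcross : ∫ z, f (z.1 - z.2) ∂(ν.prod ρ) ≤
      A * (ε ^ (d - k) * ∫ x, ‖singularPart d k x‖) := by
    rw [← integral_norm_remainder hε]
    exact integral_prod_sub_le hA hfm hfi hle
  have hρρ : 0 ≤ ∫ z, f (z.1 - z.2) ∂(ρ.prod ρ) := integral_prod_sub_nonneg hd hfm hfi hf0 hle
  have hνν := integral_empiricalMeasure_prod (x := x) hm hfm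
  -- As the potential is `0` at the origin, the diagonal of the remainder is exactly minus the
  -- self-interaction of the regularized particles.
  have hf00 : f 0 = -(ε ^ (-k) * regularPart d k 0) := by
    simp only [hf]
    rw [powerPotential_zero d hk, regularization_zero, zero_sub]
  have hdiag : 1 / (N : ℝ) ^ 2 * ((∑ i, m i ^ 2) * (ε ^ (-k) * regularPart d k 0)) ≤
      M * (ε ^ (-k) * regularPart d k 0) / N := by
    have h1 := sum_sq_le hm hM
    have h2 := regularPart_pos d hk 0
    calc 1 / (N : ℝ) ^ 2 * ((∑ i, m i ^ 2) * (ε ^ (-k) * regularPart d k 0))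
        ≤ 1 / (N : ℝ) ^ 2 * ((M * N) * (ε ^ (-k) * regularPart d k 0)) := by gcongr
      _ = _ := by field_simp
  have hpair : pairEnergy f ρ ν = ∫ z, f (z.1 - z.2) ∂(ν.prod ν) -
      2 * ∫ z, f (z.1 - z.2) ∂(ν.prod ρ) + ∫ z, f (z.1 - z.2) ∂(ρ.prod ρ) := by
    rw [pairEnergy, integral_prod_sub_comm hfe ρ ν]
    ring
  rw [hf00, mul_add] at hνν
  linarith

/-! ### Near-field interactions and comparison of scales. -/

lemma one_sub_rescale_mul_le {d : ℕ} {k ε δ l c : ℝ} {ζ : EuclideanSpace ℝ (Fin d) → ℝ}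
    (hζ : IsCutoff d ζ) (hk : 0 < k) (hε : 0 < ε) (hδ : 0 < δ) (hl : 0 < l) (hlε : l * δ ≤ ε)
    (hc0 : 0 < c) (hc : ∀ x : EuclideanSpace ℝ (Fin d), x ≠ 0 → ‖x‖ ≤ 2 / l →
      c * powerPotential d k x ≤ singularPart d k x)
    {x : EuclideanSpace ℝ (Fin d)} (hx : x ≠ 0) :
    (1 - rescale ζ δ x) * powerPotential d k x ≤
      c⁻¹ * (powerPotential d k x - regularization d k ε x) := by
  have hV := powerPotential_nonneg d k x
  have hU := singularPart_nonneg d hk (smul_ne_zero (inv_ne_zero hε.ne') hx)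
  by_cases hball : δ⁻¹ • x ∈ Metric.ball (0 : EuclideanSpace ℝ (Fin d)) 2
  · have h2 : ‖x‖ < 2 * δ := by
      rw [mem_ball_zero_iff, norm_smul, norm_inv, Real.norm_of_nonneg hδ.le, inv_mul_lt_iff₀ hδ]
        at hball
      linarith
    -- The truncation confines `x` to `|x| < 2δ`, and `l δ ≤ ε` places `x/ε` in the fixed ball where
    -- the singular part is comparable to the potential.
    have h3 : ‖ε⁻¹ • x‖ ≤ 2 / l := by
      rw [norm_smul, norm_inv, Real.norm_of_nonneg hε.le, inv_mul_le_iff₀ hε, ← mul_div_assoc,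
        le_div_iff₀ hl]
      nlinarith
    have h4 := hc _ (smul_ne_zero (inv_ne_zero hε.ne') hx) h3
    have h5 : c * powerPotential d k x ≤ powerPotential d k x - regularization d k ε x := by
      rw [powerPotential_sub_regularization hε, ← powerPotential_inv_smul hε x, mul_left_comm]
      gcongr
    calc (1 - rescale ζ δ x) * powerPotential d k x ≤ 1 * powerPotential d k x := by
          gcongr
          linarith [show 0 ≤ rescale ζ δ x from hζ.nonneg _]
      _ = c⁻¹ * (c * powerPotential d k x) := by field_simp
      _ ≤ _ := by gcongr
  · rw [rescale, hζ.eq_one _ hball, sub_self, zero_mul, powerPotential_sub_regularization hε]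
    positivity

lemma truncatedInteraction_le {d : ℕ} {k ε δ l c : ℝ} {ζ : EuclideanSpace ℝ (Fin d) → ℝ}
    (hζ : IsCutoff d ζ) (hk : 0 < k) (hε : 0 < ε) (hδ : 0 < δ) (hl : 0 < l) (hlε : l * δ ≤ ε)
    (hc0 : 0 < c) (hc : ∀ x : EuclideanSpace ℝ (Fin d), x ≠ 0 → ‖x‖ ≤ 2 / l →
      c * powerPotential d k x ≤ singularPart d k x)
    {N : ℕ} {x : Fin N → EuclideanSpace ℝ (Fin d)} (hx : ∀ i j, i ≠ j → x i ≠ x j)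
    {m : Fin N → ℝ} (hm : IsWeight m) :
    truncatedInteraction k ζ δ x m ≤
      c⁻¹ * (1 / (N : ℝ) ^ 2 * ∑ ij ∈ (Finset.univ : Finset (Fin N)).offDiag, m ij.1 * m ij.2 *
        (powerPotential d k (x ij.1 - x ij.2) - regularization d k ε (x ij.1 - x ij.2))) := by
  rw [truncatedInteraction, mul_left_comm, Finset.mul_sum _ _ c⁻¹]
  refine mul_le_mul_of_nonneg_left (Finset.sum_le_sum fun ij hij => ?_) (by positivity)
  rw [mul_left_comm c⁻¹]
  have := hm.nonneg ij.1
  have := hm.nonneg ij.2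
  exact mul_le_mul_of_nonneg_left (one_sub_rescale_mul_le hζ hk hε hδ hl hlε hc0 hc
    (sub_ne_zero.2 (hx _ _ (Finset.mem_offDiag.1 hij).2.2))) (by positivity)

lemma sum_offDiag_remainder_nonneg {d : ℕ} {k ε : ℝ} (hk : 0 < k) (hε : 0 < ε)
    {N : ℕ} {x : Fin N → EuclideanSpace ℝ (Fin d)} (hx : ∀ i j, i ≠ j → x i ≠ x j)
    {m : Fin N → ℝ} (hm : IsWeight m) :
    0 ≤ 1 / (N : ℝ) ^ 2 * ∑ ij ∈ (Finset.univ : Finset (Fin N)).offDiag, m ij.1 * m ij.2 *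
        (powerPotential d k (x ij.1 - x ij.2) - regularization d k ε (x ij.1 - x ij.2)) := by
  refine mul_nonneg (by positivity) (Finset.sum_nonneg fun ij hij => ?_)
  exact mul_nonneg (mul_nonneg (hm.nonneg _) (hm.nonneg _)) (sub_nonneg.2
    (regularization_le_powerPotential hk hε
      (sub_ne_zero.2 (hx _ _ (Finset.mem_offDiag.1 hij).2.2))))

lemma interactionConverges {d : ℕ} {k A : ℝ} (hk : 0 < k) (hkd : k < d)
    {μ : EuclideanSpace ℝ (Fin d) → ℝ} (hμ : IsBoundedDensity μ) (hμA : supNorm μ ≤ A)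
    {N : ℕ} (x : Fin N → EuclideanSpace ℝ (Fin d)) (m : Fin N → ℝ) :
    InteractionConverges d k (empiricalMeasure x m) (empiricalMeasure x m) ∧
      InteractionConverges d k (empiricalMeasure x m) (densityMeasure μ) ∧
      InteractionConverges d k (densityMeasure μ) (empiricalMeasure x m) ∧
      InteractionConverges d k (densityMeasure μ) (densityMeasure μ) := by
  have := isProbabilityMeasure_densityMeasure hμ
  have hle := densityMeasure_le hμ hμA
  have h := integrable_powerPotential_prod (α := empiricalMeasure x m) hk hkd hle
  exact ⟨(integrable_empiricalMeasure_prod (measurable_powerPotential d k)).integrableOn,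
    h.integrableOn, (integrable_powerPotential_prod_swap h).integrableOn,
    (integrable_powerPotential_prod hk hkd hle).integrableOn⟩

/-- The scale comparison behind the near-field estimate: regularizing at the length
`max ε (l δ)`, with `l = (a + 1)⁻¹`, costs at most `δ ^ s` or a multiple of `ε / δ`. -/
lemma mul_max_rpow_le {a e s u ε δ : ℝ} (ha : 0 ≤ a) (he : 1 ≤ e) (hs : s ≤ e) (hu : u ≤ 0)
    (hε0 : 0 < ε) (hε1 : ε < 1) (hδ0 : 0 < δ) (hδ1 : δ < 1) :
    a * max ε ((a + 1)⁻¹ * δ) ^ e ≤ δ ^ u * (a * (a + 1) * (ε / δ)) + δ ^ s := by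
  have hl0 : 0 < (a + 1)⁻¹ := by positivity
  have hl1 : (a + 1)⁻¹ ≤ 1 := inv_le_one_of_one_le₀ (by linarith)
  have hδs : 0 ≤ δ ^ s := by positivity
  have hδu : 1 ≤ δ ^ u := Real.one_le_rpow_of_pos_of_le_one_of_nonpos hδ0 hδ1.le hu
  rcases le_total ε ((a + 1)⁻¹ * δ) with h | h
  · rw [max_eq_right h, Real.mul_rpow hl0.le hδ0.le]
    -- The condition `e ≥ 1` gives `l^e ≤ l`, and then `a l ≤ 1` makes the coefficient of `δ ^ s`
    -- exactly one.
    have h1 : (a + 1)⁻¹ ^ e ≤ (a + 1)⁻¹ := by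
      simpa using Real.rpow_le_rpow_of_exponent_ge hl0 hl1 he
    have h2 : δ ^ e ≤ δ ^ s := Real.rpow_le_rpow_of_exponent_ge hδ0 hδ1.le hs
    have h3 : a * (a + 1)⁻¹ ≤ 1 := by
      rw [← div_eq_mul_inv, div_le_one (by linarith)]
      linarith
    calc a * ((a + 1)⁻¹ ^ e * δ ^ e) ≤ a * ((a + 1)⁻¹ * δ ^ s) := by gcongr
      _ = a * (a + 1)⁻¹ * δ ^ s := by ring
      _ ≤ 1 * δ ^ s := by gcongr
      _ ≤ _ := by
        rw [one_mul]
        exact le_add_of_nonneg_left (by positivity)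
  · rw [max_eq_left h]
    -- Here `ε / δ` is bounded below by `l`, so a bounded error is already a multiple of `ε / δ`,
    -- and `δ ^ u ≥ 1` costs nothing.
    have h1 : ε ^ e ≤ 1 := Real.rpow_le_one hε0.le hε1.le (by linarith)
    have h2 : 1 ≤ (a + 1) * (ε / δ) := by
      rw [inv_mul_le_iff₀ (by linarith)] at h
      rw [← mul_div_assoc, one_le_div hδ0]
      exact h
    calc a * ε ^ e ≤ a * 1 := by gcongr
      _ ≤ a * ((a + 1) * (ε / δ)) := by gcongr
      _ = 1 * (a * (a + 1) * (ε / δ)) := by ring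
      _ ≤ δ ^ u * (a * (a + 1) * (ε / δ)) := by gcongr
      _ ≤ _ := le_add_of_nonneg_right hδs

end

/-! ### The main theorem. -/

theorem mainTheorem6 (d : ℕ) (k p q : ℝ) (hk : 0 < k) (hkd : k < (d : ℝ) - 1)
    (hp : max ((d : ℝ) / (2 * k)) 1 < p) (hpd : p < (d : ℝ) / k) (hq : (d : ℝ) / k < q) :
    -- the constants depend only on `d, k, p, q` and (for `C`) on the bound `A` for `‖μ‖_∞`
    ∃ (C₀ : ℝ) (C : ℝ → ℝ), 0 < C₀ ∧ (∀ A, 0 < A → 0 < C A) ∧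
    ∀ r : ℕ, ∃ Vε : ℝ → EuclideanSpace ℝ (Fin d) → ℝ,
      IsRegularization d k p q C₀ r Vε ∧
      -- `ω₁` is the term `o_ε(1)`
      ∃ ω₁ : ℝ → ℝ, Tendsto ω₁ (𝓝[>] 0) (𝓝 0) ∧
      ∀ ζ : EuclideanSpace ℝ (Fin d) → ℝ, IsCutoff d ζ →
      ∀ σ : ℝ, 2 * (d : ℝ) < σ →
      ∀ A : ℝ, 0 < A →
      -- `ω₂ (ε / δ)` is the term `o_{ε/δ}(1)`
      ∃ ω₂ : ℝ → ℝ, Tendsto ω₂ (𝓝[>] 0) (𝓝 0) ∧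
      ∀ μ : EuclideanSpace ℝ (Fin d) → ℝ, IsBoundedDensity μ → supNorm μ ≤ A →
      ∀ (N : ℕ), 0 < N →
      ∀ (x : Fin N → EuclideanSpace ℝ (Fin d)) (m : Fin N → ℝ) (M : ℝ),
        (∀ i j, i ≠ j → x i ≠ x j) → IsWeight m → 0 < M → (∀ i, m i ≤ M) →
        (InteractionConverges d k (empiricalMeasure x m) (empiricalMeasure x m) ∧
          InteractionConverges d k (empiricalMeasure x m) (densityMeasure μ) ∧
          InteractionConverges d k (densityMeasure μ) (empiricalMeasure x m) ∧
          InteractionConverges d k (densityMeasure μ) (densityMeasure μ)) ∧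
        ∀ ε δ : ℝ, 0 < ε → ε < 1 → 0 < δ → δ < 1 →
          -(M * supNorm (Vε ε) / N)
              - C A * (ε / δ ^ (k + 1 - d / q) + δ ^ (d / p - k) + ω₁ ε)
            ≤ renormalizedEnergy d k (densityMeasure μ) (empiricalMeasure x m) ∧
          truncatedInteraction k ζ δ x m ≤
            C A * (renormalizedEnergy d k (densityMeasure μ) (empiricalMeasure x m)
              + (ε / δ ^ (k + 1 - d / q) + δ ^ (d - k - σ / 2) * ω₂ (ε / δ)
                + M * supNorm (Vε ε) / N + δ ^ (d / p - k))) := by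
  have hd' : (0 : ℝ) < d := by linarith
  have hd : 0 < d := by exact_mod_cast hd'
  have hkd' : k < d := by linarith
  have hp1 : 1 < p := (le_max_right _ _).trans_lt hp
  obtain ⟨C₀, hC₀, hreg⟩ := exists_isRegularization_regularization hd hk hp1.le hpd hq
  choose c hc0 hc using exists_le_singularPart d hk
  set κ : ℝ := ∫ x, ‖singularPart d k x‖ with hκ
  have hκ0 : 0 ≤ κ := integral_nonneg fun x => norm_nonneg _
  -- In `C A`, the summand `2Aκ` is the cross-term constant needed for the lower bound, and the
  -- inverse of `c` at radius `2 / l` is the near-field comparison constant. The choice `ω₁ ε = ε ^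
  -- (d - k)` is the size of the remainder in `L^1`; `ω₂` is linear, as produced by
  -- `mul_max_rpow_le`.
  refine ⟨C₀, fun A => 2 * A * κ + (c (2 / (2 * A * κ + 1)⁻¹))⁻¹, hC₀, fun A hA => ?_, fun r =>
    ⟨regularization d k, hreg r, fun ε => ε ^ (d - k), tendsto_rpow_nhdsGT_zero (by linarith),
      fun ζ hζ σ hσ A hA => ⟨fun s => 2 * A * κ * (2 * A * κ + 1) * s, ?_,
        fun μ hμ hμA N hN x m M hx hm hM0 hM =>
          ⟨interactionConverges hk hkd' hμ hμA x m, fun ε δ hε0 hε1 hδ0 hδ1 => ⟨?_, ?_⟩⟩⟩⟩⟩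
  · exact add_pos_of_nonneg_of_pos (by positivity) (inv_pos.2 (hc0 _))
  · have h : Tendsto (fun s : ℝ => 2 * A * κ * (2 * A * κ + 1) * s) (𝓝 0) (𝓝 0) := by
      simpa using (continuous_const_mul (2 * A * κ * (2 * A * κ + 1))).tendsto (0 : ℝ)
    exact h.mono_left nhdsWithin_le_nhds
  · have h1 := sum_remainder_le hk hkd' hA.le hμ hμA hN x hm hM hε0
    have h2 := sum_offDiag_remainder_nonneg (d := d) hk hε0 hx hm
    rw [supNorm_regularization hk hε0]
    have h3 : 2 * A * κ * ε ^ (d - k) ≤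
        (2 * A * κ + (c (2 / (2 * A * κ + 1)⁻¹))⁻¹) *
          (ε / δ ^ (k + 1 - d / q) + δ ^ (d / p - k) + ε ^ (d - k)) := by
      have := hc0 (2 / (2 * A * κ + 1)⁻¹)
      gcongr
      · exact le_add_of_nonneg_right (by positivity)
      · exact le_add_of_nonneg_left (by positivity)
    linarith
  · set l := (2 * A * κ + 1)⁻¹ with hl
    have hl0 : 0 < l := by positivity
    have hc0' := hc0 (2 / l)
    -- The energy inequality holds at every positive scale; this one is at least `ε`, so the
    -- self-interaction does not grow, and at least `l δ`, so the near field is controlled.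
    set ε' := max ε (l * δ)
    have hε' : 0 < ε' := lt_max_of_lt_left hε0
    have h1 := sum_remainder_le hk hkd' hA.le hμ hμA hN x hm hM hε'
    have h2 := truncatedInteraction_le hζ hk hε' hδ0 hl0 (le_max_right _ _) hc0' (hc _) hx hm
    have h3 := sum_offDiag_remainder_nonneg (d := d) hk hε' hx hm
    have h4 : 2 * A * κ * ε' ^ (d - k) ≤
        δ ^ (d - k - σ / 2) * (2 * A * κ * (2 * A * κ + 1) * (ε / δ)) + δ ^ (d / p - k) := by
      -- The exponent conditions are `d - k ≥ 1` from `k < d - 1`, `d/p ≤ d` from `p > 1`, and `d -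
      -- k - σ/2 ≤ 0` from `σ > 2d`.
      refine mul_max_rpow_le (by positivity) (by linarith) ?_ (by linarith) hε0 hε1 hδ0 hδ1
      have := div_le_self hd'.le hp1.le
      linarith
    have h5 : M * (ε' ^ (-k) * regularPart d k 0) / N ≤
        M * supNorm (regularization d k ε) / N := by
      rw [supNorm_regularization hk hε0]
      have := regularPart_pos d hk 0
      have h6 : ε' ^ (-k) ≤ ε ^ (-k) :=
        Real.rpow_le_rpow_of_nonpos hε0 (le_max_left _ _) (by linarith)
      gcongr
    have h6 : 0 ≤ ε / δ ^ (k + 1 - d / q) := by positivity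
    have h7 := h1.trans (show _ ≤ renormalizedEnergy d k (densityMeasure μ) (empiricalMeasure x m)
      + (ε / δ ^ (k + 1 - d / q)
        + δ ^ (d - k - σ / 2) * (2 * A * κ * (2 * A * κ + 1) * (ε / δ))
        + M * supNorm (regularization d k ε) / N + δ ^ (d / p - k)) by linarith)
    -- The energy may be negative, so the constant cannot be enlarged term by term. But energy plus
    -- error dominates a non-negative sum, hence is itself non-negative, and its prefactor may be
    -- raised from the inverse of `c` to `C A`.
    refine h2.trans ((mul_le_mul_of_nonneg_left h7 (by positivity)).trans ?_)
    exact mul_le_mul_of_nonneg_right (le_add_of_nonneg_left (by positivity)) (h3.trans h7)
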